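/- Let $(\Omega,\mathcal F,P,\mathbb F=(\mathcal F_t)_{t\ge 0})$ be a filtered probability space satisfying the usual hypotheses, and let $X=(X_t)_{t\ge0}$ be a non-negative càdlàg $\mathbb F$-semimartingale that admits an equivalent local martingale measure, i.e. a probability measure $Q\sim P$ under which $X$ is a local martingale. Let $S^0(\mathbb F)$ be the set of processes $H=g_0 1_{\{0\}}+\sum_{j=1}^{n-1} g_j 1_{(\tau_j,\tau_{j+1}]}$ with $n\ge 2$, bounded stopping times $0\le \tau_1\le\dots\le\tau_n$, a real number $g_0\ge 0$ and non-negative real-valued $\mathcal F_{\tau_j}$-measurable random variables $g_j$. For such $H$ put $(H\cdot X)_\infty=\sum_{j=1}^{n-1} g_j(X_{\tau_{j+1}}-X_{\tau_j})$. Let $S(\mathbb F)=S^0(\mathbb F)-S^0(\mathbb F)$, and extend $(H\cdot X)_\infty$ to it by linearity. We say that $X$ has no arbitrage in $S(\mathbb F)$ if for every $H\in S(\mathbb F)$, $(H\cdot X)_\infty\ge 0$ a.s. implies $(H\cdot X)_\infty=0$ a.s. (i) Suppose that $X$ is sticky: for all $T>0$, $\varepsilon>0$ and every stopping time $\tau$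 with $P(\tau<T)>0$, $$P\Big(\tau<T,\ \sup_{t\in[\tau,T]}|X_t-X_\tau|<\varepsilon\Big)>0 .$$ Then $X$ has no arbitrage in $S(\mathbb F)$. (ii) Suppose that, under $P$, $X$ is a time-homogeneous strong Markov process with respect to $\mathbb F$ with Borel state space $E\subseteq\mathbb R$ and laws $(P^x)_{x\in E}$ on the space of càdlàg paths: $x\mapsto P^x$ is a probability kernel, $P^x$-almost every path starts at $x$ and stays in $E$, and for every stopping time $\tau$ the conditional law of $(X_{\tau+t})_{t\ge0}$ given $\mathcal F_\tau$ is $P^{X_\tau}$ on $\{\tau<\infty\}$. Suppose also that every point $x\in E$ is regular, i.e. $\inf\{t>0:\omega_t=x\}=0$ for $P^x$-almost every path $\omega$. Then $X$ has no arbitrage in $S(\mathbb F)$. -/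

import Mathlib

open MeasureTheory ProbabilityTheory Filter Topology
open scoped NNReal ENNReal

namespace SimpleTrading

noncomputable section

/-- A path on `[0, ∞)` is càdlàg: right-continuous, with a finite left limit at every time
(at time `0` the left-limit condition is void). -/
def IsCadlag (f : ℝ≥0 → ℝ) : Prop :=
  ∀ t, ContinuousWithinAt f (Set.Ici t) t ∧ ∃ l, Tendsto f (𝓝[<] t) (𝓝 l)

/-- The space of càdlàg paths, with the σ-algebra generated by the coordinate maps. -/
abbrev CadlagPath : Type := {f : ℝ≥0 → ℝ // IsCadlag f}

variable {Ω : Type*} {mΩ : MeasurableSpace Ω}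

/-- The usual hypotheses: the filtration is right-continuous and its time-zero σ-algebra contains
all `P`-null sets of the ambient σ-algebra. -/
structure UsualHypotheses (P : Measure Ω) (𝔽 : Filtration ℝ≥0 mΩ) : Prop where
  rightContinuous : 𝔽.IsRightContinuous
  null_mem : ∀ A : Set Ω, MeasurableSet A → P A = 0 → MeasurableSet[𝔽 0] A

/-- `X` is adapted and all of its paths are càdlàg. -/
structure IsAdaptedCadlag (𝔽 : Filtration ℝ≥0 mΩ) (X : ℝ≥0 → Ω → ℝ) : Prop where
  adapted : ∀ t, Measurable[𝔽 t] (X t)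
  cadlag : ∀ ω, IsCadlag fun t => X t ω

/-- `X` is a (càdlàg) local martingale: along stopping times `τ n` increasing to infinity a.s., the
processes `X (t ∧ τ n) 1_{τ n > 0}` are martingales. -/
structure IsLocalMartingale (P : Measure Ω) (𝔽 : Filtration ℝ≥0 mΩ) (X : ℝ≥0 → Ω → ℝ) :
    Prop extends IsAdaptedCadlag 𝔽 X where
  locally_martingale : Locally (fun Y => Martingale Y 𝔽 P) 𝔽 X P

/-- `X` is a (càdlàg) semimartingale: `X = X₀ + M + A` with a local martingale `M` and an adapted
càdlàg process `A` of locally finite variation, both null at time zero. -/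
structure IsSemimartingale (P : Measure Ω) (𝔽 : Filtration ℝ≥0 mΩ) (X : ℝ≥0 → Ω → ℝ) :
    Prop extends IsAdaptedCadlag 𝔽 X where
  decomposition : ∃ M A : ℝ≥0 → Ω → ℝ,
    IsLocalMartingale P 𝔽 M ∧ IsAdaptedCadlag 𝔽 A ∧
    (∀ ω, M 0 ω = 0) ∧ (∀ ω, A 0 ω = 0) ∧
    (∀ ω, LocallyBoundedVariationOn (fun t => A t ω) Set.univ) ∧
    ∀ᵐ ω ∂P, ∀ t, X t ω = X 0 ω + M t ω + A t ω

/-- `Q` is an equivalent local martingale measure for `X`. -/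
structure IsELMM (P Q : Measure Ω) (𝔽 : Filtration ℝ≥0 mΩ) (X : ℝ≥0 → Ω → ℝ) : Prop where
  isProbabilityMeasure : IsProbabilityMeasure Q
  ac : Q ≪ P
  ac_symm : P ≪ Q
  isLocalMartingale : IsLocalMartingale Q 𝔽 X

/-- The data of a simple strategy with short sale restriction,
`g₀ 1_{0} + ∑_j g_j 1_{(τ_j, τ_{j+1}]}`, with `m ≥ 1` intervals, bounded stopping times
`τ_0 ≤ … ≤ τ_m`, and non-negative `F_{τ_j}`-measurable `g_j`. -/
structure RestrictedStrategy (𝔽 : Filtration ℝ≥0 mΩ) where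
  m : ℕ
  one_le : 1 ≤ m
  τ : Fin (m + 1) → Ω → WithTop ℝ≥0
  isStoppingTime : ∀ j, IsStoppingTime 𝔽 (τ j)
  bounded : ∀ j, ∃ c : ℝ≥0, ∀ ω, τ j ω ≤ c
  mono : ∀ ω, Monotone fun j => τ j ω
  g₀ : ℝ
  g₀_nonneg : 0 ≤ g₀
  g : Fin m → Ω → ℝ
  g_nonneg : ∀ j ω, 0 ≤ g j ω
  g_measurable : ∀ j : Fin m, Measurable[(isStoppingTime j.castSucc).measurableSpace] (g j)

/-- The integrand `g₀ 1_{0} + ∑_j g_j 1_{(τ_j, τ_{j+1}]}`. -/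
def RestrictedStrategy.integrand {𝔽 : Filtration ℝ≥0 mΩ} (V : RestrictedStrategy 𝔽) :
    ℝ≥0 → Ω → ℝ := fun t ω =>
  ({0} : Set ℝ≥0).indicator (fun _ => V.g₀) t +
    ∑ j : Fin V.m,
      {s : ℝ≥0 | V.τ j.castSucc ω < s ∧ (s : WithTop ℝ≥0) ≤ V.τ j.succ ω}.indicator
        (fun _ => V.g j ω) t

/-- The terminal gain `(H · X)_∞ = ∑_j g_j (X_{τ_{j+1}} - X_{τ_j})`; the position held at the single
time `0` earns nothing. -/
def RestrictedStrategy.gain {𝔽 : Filtration ℝ≥0 mΩ} (V : RestrictedStrategy 𝔽)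
    (X : ℝ≥0 → Ω → ℝ) : Ω → ℝ := fun ω =>
  ∑ j : Fin V.m,
    V.g j ω * (stoppedValue X (V.τ j.succ) ω - stoppedValue X (V.τ j.castSucc) ω)

/-- `S⁰(𝔽)`: the simple trading strategies with short sale restriction. -/
def restrictedStrategies (𝔽 : Filtration ℝ≥0 mΩ) : Set (ℝ≥0 → Ω → ℝ) :=
  Set.range fun V : RestrictedStrategy 𝔽 => V.integrand

/-- `S(𝔽) = S⁰(𝔽) - S⁰(𝔽)`: the simple trading strategies. -/
def simpleStrategies (𝔽 : Filtration ℝ≥0 mΩ) : Set (ℝ≥0 → Ω → ℝ) :=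
  {H | ∃ H₁ ∈ restrictedStrategies 𝔽, ∃ H₂ ∈ restrictedStrategies 𝔽, H = H₁ - H₂}

/-- `Y = (H · X)_∞` for `H ∈ S(𝔽)`, computed linearly from a representation of `H` as a difference
of two elements of `S⁰(𝔽)`. -/
def IsTerminalGain (𝔽 : Filtration ℝ≥0 mΩ) (X H : ℝ≥0 → Ω → ℝ) (Y : Ω → ℝ) : Prop :=
  ∃ V W : RestrictedStrategy 𝔽, H = V.integrand - W.integrand ∧ Y = V.gain X - W.gain X

/-- No arbitrage in `S(𝔽)`: the only a.s. non-negative terminal gain of a simple trading strategy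
is zero (losses before the end are not required to be bounded below). -/
def NoArbitrage (P : Measure Ω) (𝔽 : Filtration ℝ≥0 mΩ) (X : ℝ≥0 → Ω → ℝ) : Prop :=
  ∀ H ∈ simpleStrategies 𝔽, ∀ Y, IsTerminalGain 𝔽 X H Y → 0 ≤ᵐ[P] Y → Y =ᵐ[P] 0

/-- `X` is sticky: for every horizon `T > 0`, every `ε > 0` and every stopping time `τ` with
`P(τ < T) > 0`, with positive probability `τ < T` and `sup_{t ∈ [τ, T]} |X_t - X_τ| < ε`. -/
def IsSticky (P : Measure Ω) (𝔽 : Filtration ℝ≥0 mΩ) (X : ℝ≥0 → Ω → ℝ) : Prop :=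
  ∀ T : ℝ≥0, 0 < T → ∀ ε : ℝ, 0 < ε →
    ∀ τ : Ω → WithTop ℝ≥0, IsStoppingTime 𝔽 τ → 0 < P {ω | τ ω < T} →
      0 < P {ω | τ ω < T ∧
        (⨆ (t : ℝ≥0) (_ : τ ω ≤ t ∧ t ≤ T),
          ENNReal.ofReal |X t ω - stoppedValue X τ ω|) < ENNReal.ofReal ε}

/-- Under `P`, the process `X` is a (time-homogeneous) strong Markov process with respect to `𝔽`,
with Borel state space `E ⊆ ℝ` and with `law x` the law of the process started at `x ∈ E`:
for every stopping time `τ`, on `{τ < ∞}`, the conditional law of the post-`τ` process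
`(X_{τ+t})_{t ≥ 0}` given `F_τ` is `law (X_τ)`. -/
structure IsStrongMarkov (P : Measure Ω) (𝔽 : Filtration ℝ≥0 mΩ) (X : ℝ≥0 → Ω → ℝ)
    (E : Set ℝ) (law : Kernel E CadlagPath) : Prop where
  measurableSet_state : MeasurableSet E
  mem_state : ∀ t ω, X t ω ∈ E
  isMarkovKernel : IsMarkovKernel law
  start : ∀ x : E, ∀ᵐ p ∂(law x), p.1 0 = (x : ℝ)
  stay : ∀ x : E, ∀ᵐ p ∂(law x), ∀ t, p.1 t ∈ E
  strong_markov : ∀ (τ : Ω → WithTop ℝ≥0) (hτ : IsStoppingTime 𝔽 τ) (A : Set Ω),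
    MeasurableSet[hτ.measurableSpace] A → ∀ B : Set (ℝ≥0 → ℝ), MeasurableSet B →
      P (A ∩ {ω | τ ω < ⊤ ∧ (fun t => X ((τ ω).untopA + t) ω) ∈ B}) =
        ∫⁻ ω in A ∩ {ω | τ ω < ⊤},
          law ⟨stoppedValue X τ ω, mem_state (τ ω).untopA ω⟩
            {p : CadlagPath | p.1 ∈ B} ∂P

/-- The point `x` is regular (for itself) under the law `μ` of the process started at `x`:
`μ`-a.s. `inf {t > 0 : p t = x} = 0`, that is, the path visits `x` at arbitrarily small positive
times. -/
def IsRegularPoint (μ : Measure CadlagPath) (x : ℝ) : Prop :=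
  ∀ᵐ p ∂μ, ∀ δ : ℝ≥0, 0 < δ → ∃ t, 0 < t ∧ t < δ ∧ p.1 t = x

end

end SimpleTrading

/-! Both parts pass through `StaysClose`: no event of positive probability known at a deterministic
time `q` can force `X` to move by `ε` away from `X q` within a bounded time. Stickiness gives this
at once, by applying it to the stopping time that equals `q` on the event and `⊤` off it.

Given `StaysClose`, consider one period from `σ` to `τ` with gain `g * (X_τ - X_σ) ≥ 0`. Where `g >
0`, `X` does not lose; being a non-negative local martingale under `Q`, it has by Fatou no positive
expected increment, so the increment vanishes. Where `g < 0`, `X_τ ≤ X_σ`. If `X` rose above `X_σ`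
in between, it would be forced to come down again before a fixed horizon, which `StaysClose`
excludes. So `X ≤ X_σ` on the whole interval, the localized increments are non-positive with mean
zero, and again the increment vanishes. Several periods follow by induction on their number, and
overlapping trades are cut into successive periods by sorting all their endpoints.

In the Markov case let `F v` be the probability, under the law started at `X q`, of remaining close
for the time `v`. On an event forcing departure by time `u`, `F (u + 1) = 0`, while `F 0 = 1`. For
fixed `δ`, there is then a `k` with `F (k * δ) > 0` and `F ((k + 1) * δ) = 0`. A return to `X q` at
some time at least `δ`, without having left the ball, would let the process restart there and remain
close for a further `k * δ`, contradicting the second equality. So for every `δ` there is a.s. no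
such return on the event; regularity gives one for some `δ`, and the event is null. The restart
needs a first return time that is a stopping time. Returning is a projection of a Borel condition,
hence analytic, and the capacitability theorem replaces it by a Borel condition up to a null set. -/

namespace SimpleTrading

noncomputable section

/-! ### Measurability of analytic sets up to null sets -/

section Analytic

variable {α : Type*}

/-- One step of the capacitability argument: bounding one more coordinate of the Baire space
keeps the outer measure of the image above a given level. -/
theorem exists_coord_bound [MeasurableSpace α] (μ : Measure α) (f : (ℕ → ℕ) → α) (c : ℝ≥0∞)
    (S : Set (ℕ → ℕ)) (n : ℕ) (h : c < μ (f '' S)) :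
    ∃ m, c < μ (f '' (S ∩ {x | x n ≤ m})) := by
  have hU : f '' S = ⋃ m, f '' (S ∩ {x | x n ≤ m}) := by
    rw [← Set.image_iUnion, ← Set.inter_iUnion]
    congr 1
    ext x
    simp only [Set.mem_inter_iff, Set.mem_iUnion, Set.mem_ofPred_eq]
    exact ⟨fun hx => ⟨hx, x n, le_rfl⟩, fun hx => hx.1⟩
  have hmono : Monotone fun m => f '' (S ∩ {x | x n ≤ m}) := fun a b hab =>
    Set.image_mono fun x hx => ⟨hx.1, le_trans hx.2 hab⟩
  -- Continuity from below holds for the outer measure of arbitrary sets, so the images need not be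
  -- measurable.
  rw [hU, hmono.directed_le.measure_iUnion, lt_iSup_iff] at h
  exact h

/-- An analytic set contains compact sets of almost full outer measure. -/
theorem exists_isCompact_of_lt_analyticSet [TopologicalSpace α] [PolishSpace α] [MeasurableSpace α] [BorelSpace α]
    (μ : Measure α) [IsFiniteMeasure μ] {A : Set α} (hA : AnalyticSet A) {c : ℝ≥0∞}
    (hc : c < μ A) : ∃ K ⊆ A, IsCompact K ∧ c ≤ μ K := by
  classical
  rw [AnalyticSet] at hA
  rcases hA with rfl | ⟨f, hf, rfl⟩
  · simp at hc
  -- The coordinates are bounded one after another, without the image ever dropping to measure `c`.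
  -- By `hT` the default `0` never occurs along `T`.
  let m : Set (ℕ → ℕ) → ℕ → ℕ := fun S n =>
    if h : c < μ (f '' S) then (exists_coord_bound μ f c S n h).choose else 0
  let T : ℕ → Set (ℕ → ℕ) := fun n =>
    Nat.rec Set.univ (fun n S => S ∩ {x | x n ≤ m S n}) n
  let k : ℕ → ℕ := fun n => m (T n) n
  have hT : ∀ n, c < μ (f '' T n) := by
    intro n
    induction n with
    | zero => simpa [T, Set.image_univ] using hc
    | succ n ih =>
      have : T (n + 1) = T n ∩ {x | x n ≤ m (T n) n} := rfl
      rw [this]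
      simp only [m, dif_pos ih]
      exact (exists_coord_bound μ f c (T n) n ih).choose_spec
  have hTk : ∀ n x, x ∈ T n ↔ ∀ i < n, x i ≤ k i := by
    intro n
    induction n with
    | zero => intro x; simp [T]
    | succ n ih =>
      intro x
      have : x ∈ T (n + 1) ↔ x ∈ T n ∧ x n ≤ k n := Iff.rfl
      rw [this, ih, Nat.forall_lt_succ_right]
  have hanti : Antitone T := by
    intro a b hab x hx
    rw [hTk] at hx ⊢
    exact fun i hi => hx i (hi.trans_le hab)
  let K : Set (ℕ → ℕ) := Set.univ.pi fun i => Set.Iic (k i)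
  have hK : IsCompact K := isCompact_univ_pi fun i => (Set.finite_Iic (k i)).isCompact
  let := TopologicalSpace.upgradeIsCompletelyMetrizable α
  have hsub : ⋂ n, closure (f '' T n) ⊆ f '' K := by
    intro y hy
    have hy' : ∀ n : ℕ, ∃ x ∈ T n, dist y (f x) < 1 / ((n : ℝ) + 1) := by
      intro n
      obtain ⟨_, ⟨x, hx, rfl⟩, hd⟩ :=
        Metric.mem_closure_iff.1 (Set.mem_iInter.1 hy n) (1 / ((n : ℝ) + 1)) (by positivity)
      exact ⟨x, hx, hd⟩
    choose x hxT hxd using hy'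
    -- `x n` need not lie in the compact set `K`, but its truncation does and agrees with it in the
    -- first `n` coordinates, so both have the same limits.
    have hx'K : ∀ n, (fun i => min (x n i) (k i)) ∈ K := fun n i _ =>
      Set.mem_Iic.2 (min_le_right _ _)
    obtain ⟨z, hzK, φ, hφ, hz⟩ := hK.tendsto_subseq hx'K
    have hxz : Tendsto (x ∘ φ) atTop (𝓝 z) := by
      rw [tendsto_pi_nhds] at hz ⊢
      intro i
      refine (hz i).congr' ?_
      filter_upwards [eventually_gt_atTop i] with j hj
      exact min_eq_left ((hTk _ _).1 (hxT (φ j)) i (hj.trans_le (hφ.id_le j)))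
    have h1 : Tendsto (fun j => f (x (φ j))) atTop (𝓝 (f z)) := (hf.tendsto z).comp hxz
    have h2 : Tendsto (fun j => f (x (φ j))) atTop (𝓝 y) := by
      rw [tendsto_iff_dist_tendsto_zero]
      have h3 : Tendsto (fun j => 1 / ((φ j : ℝ) + 1)) atTop (𝓝 0) :=
        tendsto_one_div_add_atTop_nhds_zero_nat.comp hφ.tendsto_atTop
      refine squeeze_zero (fun _ => dist_nonneg) (fun j => ?_) h3
      rw [dist_comm]
      exact (hxd (φ j)).le
    exact ⟨z, hzK, tendsto_nhds_unique h1 h2⟩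
  refine ⟨f '' K, Set.image_subset_range _ _, hK.image hf, ?_⟩
  have hlim : Tendsto (fun n => μ (closure (f '' T n))) atTop (𝓝 (μ (⋂ n, closure (f '' T n)))) :=
    tendsto_measure_iInter_atTop (fun n => isClosed_closure.measurableSet.nullMeasurableSet)
      (fun a b hab => closure_mono (Set.image_mono (hanti hab))) ⟨0, measure_ne_top _ _⟩
  exact (ge_of_tendsto' hlim fun n => (hT n).le.trans (measure_mono subset_closure)).trans
    (measure_mono hsub)

/-- An analytic set contains a Borel set of full outer measure. -/
theorem exists_measurableSet_subset_analyticSet [TopologicalSpace α] [PolishSpace α] [MeasurableSpace α] [BorelSpace α]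
    (μ : Measure α) [IsFiniteMeasure μ] {A : Set α} (hA : AnalyticSet A) :
    ∃ C ⊆ A, MeasurableSet C ∧ μ C = μ A := by
  rcases eq_or_ne (μ A) 0 with h0 | h0
  · exact ⟨∅, Set.empty_subset _, MeasurableSet.empty, by simp [h0]⟩
  obtain ⟨u, -, hu, hlim⟩ := exists_seq_strictMono_tendsto' (pos_iff_ne_zero.2 h0)
  choose K hKA hK hKu using fun n => exists_isCompact_of_lt_analyticSet μ hA (hu n).2
  refine ⟨⋃ n, K n, Set.iUnion_subset hKA, MeasurableSet.iUnion fun n => (hK n).measurableSet,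
    le_antisymm (measure_mono (Set.iUnion_subset hKA)) ?_⟩
  exact le_of_tendsto' hlim fun n => (hKu n).trans (measure_mono (Set.subset_iUnion K n))

/-- An analytic set lies between two Borel sets which differ by a null set. -/
theorem exists_measurableSet_between_analyticSet [TopologicalSpace α] [PolishSpace α]
    [MeasurableSpace α] [BorelSpace α] (μ : Measure α) [IsFiniteMeasure μ] {A : Set α}
    (hA : AnalyticSet A) : ∃ C D, C ⊆ A ∧ A ⊆ D ∧ MeasurableSet C ∧ MeasurableSet D ∧
      ∀ᵐ x ∂μ, x ∈ D → x ∈ C := by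
  obtain ⟨C, hCA, hC, hμ⟩ := exists_measurableSet_subset_analyticSet μ hA
  refine ⟨C, toMeasurable μ A, hCA, subset_toMeasurable μ A, hC, measurableSet_toMeasurable μ A, ?_⟩
  have h : μ (toMeasurable μ A \ C) = 0 := by
    rw [measure_sdiff (hCA.trans (subset_toMeasurable μ A)) hC.nullMeasurableSet
      (measure_ne_top _ _), measure_toMeasurable, hμ, tsub_self]
  rw [ae_iff]
  refine measure_mono_null (fun x hx => ?_) h
  exact Classical.not_imp.1 hx

end Analytic

end

end SimpleTrading

namespace SimpleTrading

noncomputable section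

@[simp]
theorem untopA_coe (s : ℝ≥0) : (s : WithTop ℝ≥0).untopA = s := rfl

/-! ### Approximation of times from the right -/

section Discretization

/-- The first point of the grid `(n + 1)⁻¹ ℕ` strictly after `s`. -/
def gridAfter (n : ℕ) (s : ℝ≥0) : ℝ≥0 := (⌊(n + 1) * s⌋₊ + 1) / (n + 1)

theorem lt_gridAfter (n : ℕ) (s : ℝ≥0) : s < gridAfter n s := by
  rw [gridAfter, lt_div_iff₀ (by positivity), mul_comm]
  exact Nat.lt_floor_add_one _

theorem gridAfter_le (n : ℕ) (s : ℝ≥0) : gridAfter n s ≤ s + 1 / (n + 1) := by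
  rw [gridAfter, div_le_iff₀ (by positivity), add_mul s, div_mul_cancel₀ _ (by positivity),
    mul_comm s]
  gcongr
  exact Nat.floor_le zero_le

theorem gridAfter_le_add_one (n : ℕ) (s : ℝ≥0) : gridAfter n s ≤ s + 1 := by
  refine (gridAfter_le n s).trans ?_
  gcongr
  rw [div_le_one (by positivity)]
  exact le_add_self

theorem measurable_gridAfter (n : ℕ) : Measurable (gridAfter n) := by
  unfold gridAfter
  have : Measurable fun s : ℝ≥0 => ⌊((n : ℝ≥0) + 1) * s⌋₊ :=
    Nat.measurable_floor.comp (measurable_id.const_mul _)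
  exact (((measurable_from_top (f := fun k : ℕ => (k : ℝ≥0))).comp this).add_const 1).div_const _

theorem countable_range_gridAfter (n : ℕ) : (Set.range (gridAfter n)).Countable :=
  (Set.countable_range fun k : ℕ => ((k : ℝ≥0) + 1) / (n + 1)).mono <| by
    rintro _ ⟨s, rfl⟩
    exact ⟨_, rfl⟩

theorem tendsto_gridAfter (s : ℝ≥0) : Tendsto (fun n => gridAfter n s) atTop (𝓝[≥] s) := by
  refine tendsto_nhdsWithin_iff.2 ⟨?_, Eventually.of_forall fun n => (lt_gridAfter n s).le⟩
  have h : Tendsto (fun n : ℕ => s + 1 / ((n : ℝ≥0) + 1)) atTop (𝓝 (s + 0)) :=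
    tendsto_const_nhds.add tendsto_one_div_add_atTop_nhds_zero_nat
  rw [add_zero] at h
  exact tendsto_of_tendsto_of_tendsto_of_le_of_le tendsto_const_nhds h
    (fun n => (lt_gridAfter n s).le) fun n => gridAfter_le n s

/-- A right-continuous process is jointly measurable on `[0, i]` as soon as its values up to
time `i` are measurable. -/
theorem measurable_uncurry_Iic_of_rightContinuous {Ω : Type*} [MeasurableSpace Ω]
    {X : ℝ≥0 → Ω → ℝ} (i : ℝ≥0) (hX : ∀ t ≤ i, Measurable (X t))
    (hc : ∀ ω t, ContinuousWithinAt (fun t => X t ω) (Set.Ici t) t) :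
    Measurable fun p : Set.Iic i × Ω => X p.1 p.2 := by
  have hlim : ∀ p : Set.Iic i × Ω, Tendsto (fun n => X (min i (gridAfter n p.1)) p.2) atTop
      (𝓝 (X p.1 p.2)) := by
    rintro ⟨⟨s, hs⟩, ω⟩
    have h1 : Tendsto (fun n => min i (gridAfter n s)) atTop (𝓝[≥] s) := by
      refine tendsto_nhdsWithin_iff.2
        ⟨?_, Eventually.of_forall fun n => le_min hs (lt_gridAfter n s).le⟩
      have := (tendsto_const_nhds (x := i)).min
        ((tendsto_gridAfter s).mono_right nhdsWithin_le_nhds)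
      rwa [min_eq_right (show s ≤ i from hs)] at this
    exact (hc ω s).tendsto.comp h1
  refine measurable_of_tendsto_metrizable (f := fun n (p : Set.Iic i × Ω) =>
    X (min i (gridAfter n p.1)) p.2) (fun n => ?_) (tendsto_pi_nhds.2 hlim)
  -- The approximating time depends on `s` only through an integer; joint measurability then needs
  -- only countably many times, all at most `i`.
  let c : ℕ → ℝ≥0 := fun k => min i (((k : ℝ≥0) + 1) / (n + 1))
  have hc : ∀ k, c k ≤ i := fun k => min_le_left _ _
  have hgrid : ∀ s, min i (gridAfter n s) = c ⌊((n : ℝ≥0) + 1) * s⌋₊ := fun s => rfl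
  clear_value c
  simp_rw [hgrid]
  have h2 : Measurable fun q : ℕ × Ω => X (c q.1) q.2 :=
    measurable_from_prod_countable_right fun k => hX (c k) (hc k)
  have h3 : Measurable fun p : Set.Iic i × Ω => ⌊((n : ℝ≥0) + 1) * (p.1 : ℝ≥0)⌋₊ :=
    Nat.measurable_floor.comp ((measurable_subtype_coe.comp measurable_fst).const_mul _)
  exact h2.comp (h3.prodMk measurable_snd)

variable {Ω : Type*} {mΩ : MeasurableSpace Ω} {𝔽 : Filtration ℝ≥0 mΩ}

/-- A right-continuous adapted real process is progressively measurable. -/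
theorem isStronglyProgressive_of_rightContinuous {X : ℝ≥0 → Ω → ℝ}
    (hX : ∀ t, Measurable[𝔽 t] (X t))
    (hc : ∀ ω t, ContinuousWithinAt (fun t => X t ω) (Set.Ici t) t) :
    IsStronglyProgressive 𝔽 X := by
  refine IsProgressive.isStronglyProgressive fun i => ?_
  exact @measurable_uncurry_Iic_of_rightContinuous Ω (𝔽 i) X i
    (fun t ht => (hX t).mono (𝔽.mono ht) le_rfl) hc

/-- A measurable function of a bounded stopping time which only delays it is a stopping time. -/
theorem isStoppingTime_comp_of_le {τ : Ω → WithTop ℝ≥0} (hτ : IsStoppingTime 𝔽 τ)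
    (hτ' : ∀ ω, τ ω ≠ ⊤) {φ : ℝ≥0 → ℝ≥0} (hφ : Measurable φ) (hle : ∀ s, s ≤ φ s) :
    IsStoppingTime 𝔽 fun ω => (φ (τ ω).untopA : WithTop ℝ≥0) := by
  intro t
  -- Since `φ` only delays, `φ τ ≤ t` forces `τ ≤ t`, so `τ` may be replaced by `min τ t`, which is
  -- known at `t`.
  have h : {ω | (φ (τ ω).untopA : WithTop ℝ≥0) ≤ t} =
      {ω | φ (min (τ ω) t).untopA ≤ t} ∩ {ω | τ ω ≤ t} := by
    ext ω
    obtain ⟨s, hs⟩ := WithTop.ne_top_iff_exists.1 (hτ' ω)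
    simp only [Set.mem_ofPred_eq, Set.mem_inter_iff, ← hs, WithTop.coe_le_coe]
    rw [← WithTop.coe_min]
    simp only [untopA_coe]
    constructor
    · intro h
      have hst := (hle s).trans h
      rw [min_eq_left hst]
      exact ⟨h, hst⟩
    · rintro ⟨h, hst⟩
      rwa [min_eq_left hst] at h
  rw [h]
  refine MeasurableSet.inter ?_ (hτ t)
  have hm : Measurable[𝔽 t] fun ω => (min (τ ω) t).untopA :=
    ((hτ.min_const t).measurable_of_le fun _ => min_le_right _ _).untopA
  exact (hφ.comp hm) measurableSet_Iic

end Discretization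

/-! ### Optional sampling in continuous time -/

section OptionalSampling

variable {Ω : Type*} {mΩ : MeasurableSpace Ω} {𝔽 : Filtration ℝ≥0 mΩ} {Q : Measure Ω}
  [IsFiniteMeasure Q]

/-- Optional sampling for a right-continuous martingale at a bounded stopping time. -/
theorem Martingale.setIntegral_stoppedValue {M : ℝ≥0 → Ω → ℝ} (hM : Martingale M 𝔽 Q)
    (hc : ∀ ω t, ContinuousWithinAt (fun t => M t ω) (Set.Ici t) t)
    {τ : Ω → WithTop ℝ≥0} (hτ : IsStoppingTime 𝔽 τ) {T : ℝ≥0} (hT : ∀ ω, τ ω ≤ T) :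
    Integrable (stoppedValue M τ) Q ∧
      ∀ A, MeasurableSet[hτ.measurableSpace] A →
        ∫ ω in A, stoppedValue M τ ω ∂Q = ∫ ω in A, M (T + 1) ω ∂Q := by
  have htop : ∀ ω, τ ω ≠ ⊤ := fun ω => ne_top_of_le_ne_top WithTop.coe_ne_top (hT ω)
  let σ : ℕ → Ω → WithTop ℝ≥0 := fun n ω => (gridAfter n (τ ω).untopA : WithTop ℝ≥0)
  have hσ : ∀ n, IsStoppingTime 𝔽 (σ n) := fun n =>
    isStoppingTime_comp_of_le hτ htop (measurable_gridAfter n) fun s => (lt_gridAfter n s).le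
  -- The grid overshoots by at most `1`, hence the horizon `T + 1`.
  have hσT : ∀ n ω, σ n ω ≤ (T + 1 : ℝ≥0) := by
    intro n ω
    refine WithTop.coe_le_coe.2 ((gridAfter_le_add_one n _).trans ?_)
    gcongr
    exact WithTop.untopA_le (hT ω)
  have hτσ : ∀ n, τ ≤ σ n := by
    intro n ω
    obtain ⟨s, hs⟩ := WithTop.ne_top_iff_exists.1 (htop ω)
    simp only [σ, ← hs, untopA_coe, WithTop.coe_le_coe]
    exact (lt_gridAfter n s).le
  have hcount : ∀ n, (Set.range (σ n)).Countable := fun n =>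
    ((countable_range_gridAfter n).image fun s : ℝ≥0 => (s : WithTop ℝ≥0)).mono <| by
      rintro _ ⟨ω, rfl⟩
      exact ⟨_, ⟨_, rfl⟩, rfl⟩
  have hcond : ∀ n, stoppedValue M (σ n) =ᵐ[Q] Q[M (T + 1) | (hσ n).measurableSpace] := fun n =>
    hM.stoppedValue_ae_eq_condExp_of_le_const_of_countable_range (hσ n) (hσT n) (hcount n)
  -- All discretized values are conditional expectations of the single variable `M (T + 1)`; uniform
  -- integrability upgrades pointwise convergence to convergence in `L¹`.
  have hui : UniformIntegrable (fun n => stoppedValue M (σ n)) 1 Q :=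
    ((hM.integrable (T + 1)).uniformIntegrable_condExp
      fun n => (hσ n).measurableSpace_le).ae_eq fun n => (hcond n).symm
  have hlim : ∀ ω, Tendsto (fun n => stoppedValue M (σ n) ω) atTop (𝓝 (stoppedValue M τ ω)) :=
    fun ω => (hc ω (τ ω).untopA).tendsto.comp (tendsto_gridAfter _)
  have hL : MemLp (stoppedValue M τ) 1 Q :=
    hui.memLp_of_ae_tendsto (ae_of_all _ hlim)
  have hL1 := tendsto_Lp_finite_of_tendsto_ae le_rfl ENNReal.one_ne_top hui.1 hL hui.2.1
    (ae_of_all _ hlim)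
  have hint : Integrable (stoppedValue M τ) Q := memLp_one_iff_integrable.1 hL
  refine ⟨hint, fun A hA => ?_⟩
  have hconv : Tendsto (fun n => ∫ ω in A, stoppedValue M (σ n) ω ∂Q) atTop
      (𝓝 (∫ ω in A, stoppedValue M τ ω ∂Q)) := by
    refine tendsto_setIntegral_of_L1' _ hint.aestronglyMeasurable
      (Eventually.of_forall fun n => memLp_one_iff_integrable.1 (hui.memLp n)) hL1 A
  refine tendsto_nhds_unique hconv (tendsto_const_nhds.congr fun n => ?_)
  have hAn : MeasurableSet[(hσ n).measurableSpace] A :=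
    hτ.measurableSpace_mono (hσ n) (hτσ n) A hA
  rw [setIntegral_congr_ae (g := Q[M (T + 1) | (hσ n).measurableSpace])
      ((hσ n).measurableSpace_le A hAn) ((hcond n).mono fun ω h _ => h),
    setIntegral_condExp (hσ n).measurableSpace_le (hM.integrable _) hAn]

end OptionalSampling

end

end SimpleTrading

namespace SimpleTrading

noncomputable section

/-! ### Increments of local martingales between stopping times -/

variable {Ω : Type*} {mΩ : MeasurableSpace Ω} {𝔽 : Filtration ℝ≥0 mΩ} {P Q : Measure Ω}
  {X : ℝ≥0 → Ω → ℝ}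

/-- Paths of a stopped process are right-continuous where those of the process are. -/
theorem continuousWithinAt_stoppedProcess_indicator (τ : Ω → WithTop ℝ≥0) (ω : Ω)
    (hc : ∀ t, ContinuousWithinAt (fun t => X t ω) (Set.Ici t) t) (S : Set Ω) (t : ℝ≥0) :
    ContinuousWithinAt (fun t => stoppedProcess (fun i => S.indicator (X i)) τ t ω)
      (Set.Ici t) t := by
  by_cases hω : ω ∈ S
  · simp only [stoppedProcess, Set.indicator_of_mem hω]
    rcases eq_or_ne (τ ω) ⊤ with h | h
    · simpa only [h, min_top_right, untopA_coe] using hc t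
    · obtain ⟨c, hcτ⟩ := WithTop.ne_top_iff_exists.1 h
      simp only [← hcτ, ← WithTop.coe_min, untopA_coe]
      exact ContinuousWithinAt.comp (g := fun t => X t ω) (f := fun r => min r c) (hc (min t c))
        (continuous_id.min continuous_const).continuousWithinAt
        fun r hr => min_le_min_right c hr
  · simp only [stoppedProcess, Set.indicator_of_notMem hω]
    exact continuousWithinAt_const

/-- Between two bounded stopping times, the increment of a local martingale restricted to an event
known at the first one is the a.s. eventual value of centred integrable variables, each of which
is at every point zero or an increment up to an intermediate time. -/
theorem IsLocalMartingale.exists_approx_increment [IsFiniteMeasure Q]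
    (hX : IsLocalMartingale Q 𝔽 X) {σ τ : Ω → WithTop ℝ≥0} (hσ : IsStoppingTime 𝔽 σ)
    (hτ : IsStoppingTime 𝔽 τ) (hστ : σ ≤ τ) {T : ℝ≥0} (hT : ∀ ω, τ ω ≤ T) {A : Set Ω}
    (hA : MeasurableSet[hσ.measurableSpace] A) :
    ∃ φ : ℕ → Ω → ℝ, (∀ n, Integrable (φ n) Q) ∧ (∀ n, ∫ ω, φ n ω ∂Q = 0) ∧
      (∀ n ω, φ n ω = 0 ∨ (ω ∈ A ∧ ∃ t : ℝ≥0, σ ω ≤ t ∧ t ≤ τ ω ∧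
        φ n ω = X t ω - stoppedValue X σ ω)) ∧
      ∀ᵐ ω ∂Q, ∀ᶠ n in atTop,
        φ n ω = A.indicator (fun ω => stoppedValue X τ ω - stoppedValue X σ ω) ω := by
  obtain ⟨ρ, hρ, hM⟩ := hX.locally_martingale
  let M : ℕ → ℝ≥0 → Ω → ℝ := fun n =>
    stoppedProcess (fun i => {ω | ⊥ < ρ n ω}.indicator (X i)) (ρ n)
  have hMc : ∀ n ω t, ContinuousWithinAt (fun t => M n t ω) (Set.Ici t) t := fun n ω t =>
    continuousWithinAt_stoppedProcess_indicator (ρ n) ω (fun t => (hX.cadlag ω t).1) _ t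
  have hσT : ∀ ω, σ ω ≤ T := fun ω => (hστ ω).trans (hT ω)
  -- On this event localization has not yet stopped `X` at `σ`; it also gives `⊥ < ρ n ω`, so the
  -- indicator in the localized process is harmless.
  let B : ℕ → Set Ω := fun n => A ∩ {ω | σ ω < ρ n ω}
  have hB : ∀ n, MeasurableSet[hσ.measurableSpace] (B n) := by
    intro n
    have h := ((hρ.isStoppingTime n).measurableSet_stopping_time_le hσ).compl
    refine hA.inter ?_
    convert! h using 1
    ext ω
    simp
  have hBm : ∀ n, MeasurableSet (B n) := fun n => hσ.measurableSpace_le _ (hB n)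
  have hMσ : ∀ n, ∀ ω ∈ B n, stoppedValue (M n) σ ω = stoppedValue X σ ω := by
    rintro n ω ⟨-, hω⟩
    obtain ⟨s, hs⟩ := WithTop.ne_top_iff_exists.1 (ne_top_of_le_ne_top WithTop.coe_ne_top (hσT ω))
    simp only [Set.mem_ofPred_eq] at hω
    have hω' : ω ∈ {ω | ⊥ < ρ n ω} := bot_le.trans_lt hω
    simp only [M, stoppedValue, stoppedProcess, Set.indicator_of_mem hω']
    rw [← hs] at hω ⊢
    rw [untopA_coe, min_eq_left hω.le, untopA_coe]
  have hMτ : ∀ n, ∀ ω ∈ B n,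
      stoppedValue (M n) τ ω = X (min (τ ω) (ρ n ω)).untopA ω := by
    rintro n ω ⟨-, hω⟩
    obtain ⟨s, hs⟩ := WithTop.ne_top_iff_exists.1 (ne_top_of_le_ne_top WithTop.coe_ne_top (hT ω))
    simp only [Set.mem_ofPred_eq] at hω
    have hω' : ω ∈ {ω | ⊥ < ρ n ω} := bot_le.trans_lt hω
    simp only [M, stoppedValue, stoppedProcess, Set.indicator_of_mem hω']
    rw [← hs, untopA_coe]
  have hsτ := fun n => Martingale.setIntegral_stoppedValue (hM n) (hMc n) hτ hT
  have hsσ := fun n => Martingale.setIntegral_stoppedValue (hM n) (hMc n) hσ hσT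
  refine ⟨fun n => (B n).indicator fun ω => stoppedValue (M n) τ ω - stoppedValue (M n) σ ω,
    fun n => ((hsτ n).1.sub (hsσ n).1).indicator (hBm n), fun n => ?_, fun n ω => ?_, ?_⟩
  · rw [integral_indicator (hBm n), integral_sub (hsτ n).1.integrableOn (hsσ n).1.integrableOn,
      (hsτ n).2 _ (hσ.measurableSpace_mono hτ hστ _ (hB n)), (hsσ n).2 _ (hB n), sub_self]
  · by_cases hω : ω ∈ B n
    · refine Or.inr ⟨hω.1, (min (τ ω) (ρ n ω)).untopA, ?_⟩
      obtain ⟨s, hs⟩ := WithTop.ne_top_iff_exists.1 (ne_top_of_le_ne_top WithTop.coe_ne_top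
        ((min_le_left (τ ω) (ρ n ω)).trans (hT ω)))
      have h1 := hMτ n ω hω
      rw [← hs, untopA_coe] at h1 ⊢
      dsimp only
      rw [Set.indicator_of_mem hω, hMσ n ω hω, h1]
      have h2 : σ ω < ρ n ω := hω.2
      exact ⟨hs ▸ le_min (hστ ω) h2.le, hs ▸ min_le_left _ _, rfl⟩
    · exact Or.inl (Set.indicator_of_notMem hω _)
  · filter_upwards [hρ.tendsto_top] with ω hω
    filter_upwards [hω.eventually (Ioi_mem_nhds (WithTop.coe_lt_top T))] with n hn
    have hn' : (T : WithTop ℝ≥0) < ρ n ω := hn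
    by_cases hωA : ω ∈ A
    · have hωB : ω ∈ B n := ⟨hωA, (hσT ω).trans_lt hn'⟩
      rw [Set.indicator_of_mem hωB, Set.indicator_of_mem hωA, hMσ n ω hωB, hMτ n ω hωB,
        min_eq_left ((hT ω).trans hn'.le)]
      rfl
    · rw [Set.indicator_of_notMem hωA, Set.indicator_of_notMem fun h => hωA h.1]

/-- If a local martingale never exceeds its value at `σ` before `τ`, it agrees at both times. -/
theorem IsLocalMartingale.stoppedValue_eq_of_le [IsFiniteMeasure Q]
    (hX : IsLocalMartingale Q 𝔽 X) {σ τ : Ω → WithTop ℝ≥0} (hσ : IsStoppingTime 𝔽 σ)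
    (hτ : IsStoppingTime 𝔽 τ) (hστ : σ ≤ τ) {T : ℝ≥0} (hT : ∀ ω, τ ω ≤ T) {A : Set Ω}
    (hA : MeasurableSet[hσ.measurableSpace] A)
    (hle : ∀ᵐ ω ∂Q, ω ∈ A → ∀ t : ℝ≥0, σ ω ≤ t → t ≤ τ ω → X t ω ≤ stoppedValue X σ ω) :
    ∀ᵐ ω ∂Q, ω ∈ A → stoppedValue X τ ω = stoppedValue X σ ω := by
  obtain ⟨φ, hφi, hφ0, hφ, hlim⟩ := hX.exists_approx_increment hσ hτ hστ hT hA
  have hzero : ∀ n, ∀ᵐ ω ∂Q, φ n ω = 0 := by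
    intro n
    have hnn : 0 ≤ᵐ[Q] fun ω => -φ n ω := by
      filter_upwards [hle] with ω hω
      rcases hφ n ω with h | ⟨hωA, t, h1, h2, h⟩
      · simp [h]
      · have := hω hωA t h1 h2
        simp only [Pi.zero_apply]
        linarith
    have hint : ∫ ω, -φ n ω ∂Q = 0 := by rw [integral_neg, hφ0, neg_zero]
    filter_upwards [(integral_eq_zero_iff_of_nonneg_ae hnn (hφi n).neg).1 hint] with ω hω
    simpa using hω
  filter_upwards [ae_all_iff.2 hzero, hlim] with ω h0 hl hωA
  obtain ⟨n, hn⟩ := hl.exists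
  rw [h0 n, Set.indicator_of_mem hωA] at hn
  linarith

/-- A non-negative local martingale which is at least as large at `τ` as it is at `σ ≤ τ` agrees
at both times. -/
theorem IsLocalMartingale.stoppedValue_eq_of_ge [IsFiniteMeasure Q]
    (hX : IsLocalMartingale Q 𝔽 X) (hnn : ∀ t ω, 0 ≤ X t ω) {σ τ : Ω → WithTop ℝ≥0}
    (hσ : IsStoppingTime 𝔽 σ) (hτ : IsStoppingTime 𝔽 τ) (hστ : σ ≤ τ) {T : ℝ≥0}
    (hT : ∀ ω, τ ω ≤ T) {A : Set Ω} (hA : MeasurableSet[hσ.measurableSpace] A)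
    (hge : ∀ᵐ ω ∂Q, ω ∈ A → stoppedValue X σ ω ≤ stoppedValue X τ ω) :
    ∀ᵐ ω ∂Q, ω ∈ A → stoppedValue X τ ω = stoppedValue X σ ω := by
  have hprog : IsStronglyProgressive 𝔽 X :=
    isStronglyProgressive_of_rightContinuous hX.adapted fun ω t => (hX.cadlag ω t).1
  have hXσ := measurable_stoppedValue hprog hσ
  -- Where `X_σ ≤ K`, non-negativity of `X` bounds all increments from below by `-K`; this is what
  -- makes Fatou applicable.
  suffices h : ∀ K : ℕ, ∀ᵐ ω ∂Q, ω ∈ A ∩ {ω | stoppedValue X σ ω ≤ K} →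
      stoppedValue X τ ω = stoppedValue X σ ω by
    filter_upwards [ae_all_iff.2 h] with ω hω hωA
    obtain ⟨K, hK⟩ := exists_nat_ge (stoppedValue X σ ω)
    exact hω K ⟨hωA, hK⟩
  intro K
  have hAK : MeasurableSet[hσ.measurableSpace] (A ∩ {ω | stoppedValue X σ ω ≤ K}) :=
    hA.inter (hXσ measurableSet_Iic)
  obtain ⟨φ, hφi, hφ0, hφ, hlim⟩ := hX.exists_approx_increment hσ hτ hστ hT hAK
  set Y : Ω → ℝ := (A ∩ {ω | stoppedValue X σ ω ≤ K}).indicator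
    fun ω => stoppedValue X τ ω - stoppedValue X σ ω with hY
  have hφK : ∀ n ω, 0 ≤ φ n ω + K := by
    intro n ω
    rcases hφ n ω with h | ⟨hωA, t, -, -, h⟩
    · rw [h, zero_add]
      exact Nat.cast_nonneg K
    · have h1 : stoppedValue X σ ω ≤ K := hωA.2
      have h2 := hnn t ω
      linarith
  have hYnn : 0 ≤ᵐ[Q] Y := by
    filter_upwards [hge] with ω hω
    exact Set.indicator_apply_nonneg fun h => sub_nonneg.2 (hω h.1)
  have hliminf : ∀ᵐ ω ∂Q, ENNReal.ofReal (Y ω) + ENNReal.ofReal K =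
      liminf (fun n => ENNReal.ofReal (φ n ω + K)) atTop := by
    filter_upwards [hlim, hYnn] with ω hω hωY
    rw [← ENNReal.ofReal_add hωY (Nat.cast_nonneg K)]
    refine (Tendsto.liminf_eq ?_).symm
    refine tendsto_const_nhds.congr' ?_
    filter_upwards [hω] with n hn
    rw [hn]
  have hint : ∀ n, ∫⁻ ω, ENNReal.ofReal (φ n ω + K) ∂Q = ENNReal.ofReal (∫ _, (K : ℝ) ∂Q) := by
    intro n
    rw [← ofReal_integral_eq_lintegral_ofReal (f := fun ω => φ n ω + K)
      ((hφi n).add (integrable_const _)) (ae_of_all _ (hφK n)), integral_add (hφi n) (integrable_const _), hφ0, zero_add]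
  have hKint : ∫⁻ _, ENNReal.ofReal (K : ℝ) ∂Q = ENNReal.ofReal (∫ _, (K : ℝ) ∂Q) :=
    (ofReal_integral_eq_lintegral_ofReal (integrable_const _)
      (ae_of_all _ fun _ => Nat.cast_nonneg K)).symm
  have hFatou : ∫⁻ ω, ENNReal.ofReal (Y ω) ∂Q + ENNReal.ofReal (∫ _, (K : ℝ) ∂Q) ≤
      0 + ENNReal.ofReal (∫ _, (K : ℝ) ∂Q) := by
    calc ∫⁻ ω, ENNReal.ofReal (Y ω) ∂Q + ENNReal.ofReal (∫ _, (K : ℝ) ∂Q)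
        = ∫⁻ ω, liminf (fun n => ENNReal.ofReal (φ n ω + K)) atTop ∂Q := by
          rw [← hKint, ← lintegral_add_right _ measurable_const]
          exact lintegral_congr_ae hliminf
      _ ≤ liminf (fun n => ∫⁻ ω, ENNReal.ofReal (φ n ω + K) ∂Q) atTop :=
          lintegral_liminf_le' fun n =>
            ((hφi n).aestronglyMeasurable.aemeasurable.add_const _).ennreal_ofReal
      _ = 0 + ENNReal.ofReal (∫ _, (K : ℝ) ∂Q) := by simp [hint]
  have hY0 : ∫⁻ ω, ENNReal.ofReal (Y ω) ∂Q = 0 :=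
    le_antisymm (ENNReal.le_of_add_le_add_right ENNReal.ofReal_ne_top hFatou) zero_le
  have hYm : AEMeasurable Y Q := by
    refine aemeasurable_of_tendsto_metrizable_ae atTop
      (fun n => (hφi n).aestronglyMeasurable.aemeasurable) ?_
    filter_upwards [hlim] with ω hω
    exact tendsto_const_nhds.congr' (hω.mono fun n hn => hn.symm)
  filter_upwards [(lintegral_eq_zero_iff' hYm.ennreal_ofReal).1 hY0, hYnn] with ω h0 h1 hωA
  have h2 : Y ω = stoppedValue X τ ω - stoppedValue X σ ω := Set.indicator_of_mem hωA _
  have h3 : Y ω ≤ 0 := ENNReal.ofReal_eq_zero.1 h0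
  have h4 : 0 ≤ Y ω := h1
  linarith

/-! ### Trading over one period -/

/-- A form of stickiness at deterministic times: no event known at time `q` forces the process to
move away from `X q` by some fixed amount before time `q + u`. -/
def StaysClose (P : Measure Ω) (𝔽 : Filtration ℝ≥0 mΩ) (X : ℝ≥0 → Ω → ℝ) : Prop :=
  ∀ (q u : ℝ≥0) (ε : ℝ), 0 < ε → ∀ B : Set Ω, MeasurableSet[𝔽 q] B →
    (∀ᵐ ω ∂P, ω ∈ B → ∃ s ≤ u, ε ≤ |X (q + s) ω - X q ω|) → P B = 0

/-- Under `StaysClose`, an event known at `σ` on which `X` does not increase from `σ` to `τ` does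
not let `X` exceed its value at `σ` in between. -/
theorem StaysClose.le_stoppedValue (hS : StaysClose P 𝔽 X) (hX : IsAdaptedCadlag 𝔽 X)
    {σ τ : Ω → WithTop ℝ≥0} (hσ : IsStoppingTime 𝔽 σ) (hτ : IsStoppingTime 𝔽 τ)
    {T : ℝ≥0} (hT : ∀ ω, τ ω ≤ T) {A : Set Ω}
    (hA : MeasurableSet[hσ.measurableSpace] A)
    (hle : ∀ᵐ ω ∂P, ω ∈ A → stoppedValue X τ ω ≤ stoppedValue X σ ω) :
    ∀ᵐ ω ∂P, ω ∈ A → ∀ t : ℝ≥0, σ ω ≤ t → t ≤ τ ω → X t ω ≤ stoppedValue X σ ω := by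
  have hprog : IsStronglyProgressive 𝔽 X :=
    isStronglyProgressive_of_rightContinuous hX.adapted fun ω t => (hX.cadlag ω t).1
  obtain ⟨D, hDc, hD⟩ := TopologicalSpace.exists_countable_dense ℝ≥0
  have key : ∀ q ∈ D, ∀ n : ℕ, ∀ᵐ ω ∂P, ω ∈ A → σ ω ≤ q → q < τ ω →
      X q ω ≤ stoppedValue X σ ω + 1 / ((n : ℝ) + 1) := by
    intro q _ n
    -- Here `X q` exceeds `X_σ` by more than `1 / (n + 1)` while `τ` is still to come; as `X_τ ≤
    -- X_σ`, the process must fall by that amount within the time `T`.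
    let B : Set Ω := (A ∩ {ω | stoppedValue X σ ω < X q ω - 1 / ((n : ℝ) + 1)} ∩ {ω | σ ω ≤ q}) ∩
      {ω | τ ω ≤ q}ᶜ
    have hB : MeasurableSet[𝔽 q] B := by
      refine MeasurableSet.inter ?_ (hτ q).compl
      have h1 : A ∩ {ω | stoppedValue X σ ω < X q ω - 1 / ((n : ℝ) + 1)} ∩ {ω | σ ω ≤ q} =
          (A ∩ {ω | σ ω ≤ q}) ∩ {ω | stoppedValue X (fun ω => min (σ ω) q) ω <
            X q ω - 1 / ((n : ℝ) + 1)} := by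
        ext ω
        simp only [Set.mem_inter_iff, Set.mem_ofPred_eq, stoppedValue]
        constructor
        · rintro ⟨⟨h1, h2⟩, h3⟩
          rw [min_eq_left h3]
          exact ⟨⟨h1, h3⟩, h2⟩
        · rintro ⟨⟨h1, h3⟩, h2⟩
          rw [min_eq_left h3] at h2
          exact ⟨⟨h1, h2⟩, h3⟩
      rw [h1]
      refine (hA.2 q).inter ?_
      have h2 : Measurable[𝔽 q] (stoppedValue X fun ω => min (σ ω) q) :=
        (stronglyMeasurable_stoppedValue_of_le hprog (hσ.min_const q)
          fun _ => min_le_right _ _).measurable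
      exact @measurableSet_lt _ _ _ _ _ (𝔽 q) _ _ _ _ _ h2 ((hX.adapted q).sub_const _)
    have hPB : P B = 0 := by
      refine hS q T (1 / ((n : ℝ) + 1)) (by positivity) B hB ?_
      filter_upwards [hle] with ω hω hωB
      obtain ⟨⟨⟨hωA, h1⟩, h2⟩, h3⟩ := hωB
      simp only [Set.mem_ofPred_eq, Set.mem_compl_iff, not_le] at h1 h2 h3
      have h4 := hω hωA
      obtain ⟨t, ht⟩ := WithTop.ne_top_iff_exists.1
        (ne_top_of_le_ne_top WithTop.coe_ne_top (hT ω))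
      have h5 : t ≤ T := WithTop.coe_le_coe.1 (ht ▸ hT ω)
      have h6 : q < t := WithTop.coe_lt_coe.1 (ht ▸ h3)
      refine ⟨t - q, tsub_le_self.trans h5, ?_⟩
      rw [add_tsub_cancel_of_le h6.le, abs_sub_comm]
      have h7 : stoppedValue X τ ω = X t ω := by rw [stoppedValue, ← ht, untopA_coe]
      rw [h7] at h4
      refine le_trans ?_ (le_abs_self _)
      linarith
    filter_upwards [measure_eq_zero_iff_ae_notMem.1 hPB] with ω hω hωA h1 h2
    by_contra! h3
    refine hω ⟨⟨⟨hωA, ?_⟩, h1⟩, ?_⟩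
    · simp only [Set.mem_ofPred_eq]
      linarith
    · exact fun h => absurd h2 (not_lt.2 h)
  have key' := (ae_ball_iff hDc).2 fun q hq => ae_all_iff.2 (key q hq)
  filter_upwards [hle, key'] with ω hω hk hωA t h1 h2
  -- The end point is the hypothesis itself; before it, right-continuity carries the bound from `D`
  -- to every `t`.
  rcases h2.eq_or_lt with h2 | h2
  · have := hω hωA
    rwa [stoppedValue, ← h2, untopA_coe] at this
  have hk' : ∀ q ∈ D, σ ω ≤ q → q < τ ω → X q ω ≤ stoppedValue X σ ω := by
    intro q hq h3 h4
    refine le_of_forall_pos_le_add fun ε hε => ?_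
    obtain ⟨n, hn⟩ := exists_nat_one_div_lt hε
    exact (hk q hq n hωA h3 h4).trans (by linarith)
  by_contra! h3
  obtain ⟨r, hr⟩ := WithTop.ne_top_iff_exists.1 (ne_top_of_le_ne_top WithTop.coe_ne_top (hT ω))
  rw [← hr] at h2
  have htr : t < r := WithTop.coe_lt_coe.1 h2
  have h4 : ∀ᶠ s in 𝓝[≥] t, stoppedValue X σ ω < X s ω :=
    (hX.cadlag ω t).1.tendsto.eventually (Ioi_mem_nhds h3)
  obtain ⟨u, htu, hu⟩ := (mem_nhdsGE_iff_exists_Ico_subset' htr).1 h4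
  obtain ⟨q, hqD, hq⟩ := hD.exists_between (lt_min htr htu)
  have h5 : q < r := hq.2.trans_le (min_le_left _ _)
  have h6 : q < u := hq.2.trans_le (min_le_right _ _)
  have h7 : stoppedValue X σ ω < X q ω := hu ⟨hq.1.le, h6⟩
  refine absurd (hk' q hqD (h1.trans (WithTop.coe_le_coe.2 hq.1.le)) ?_) (not_le.2 h7)
  rw [← hr]
  exact WithTop.coe_lt_coe.2 h5

/-- There is no arbitrage in a single period between two bounded stopping times. -/
theorem StaysClose.noArbitrage_onePeriod (hS : StaysClose P 𝔽 X) (hnn : ∀ t ω, 0 ≤ X t ω)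
    (hQ : IsELMM P Q 𝔽 X) {σ τ : Ω → WithTop ℝ≥0} (hσ : IsStoppingTime 𝔽 σ)
    (hτ : IsStoppingTime 𝔽 τ) (hστ : σ ≤ τ) {T : ℝ≥0} (hT : ∀ ω, τ ω ≤ T) {g : Ω → ℝ}
    (hg : Measurable[hσ.measurableSpace] g)
    (h0 : ∀ᵐ ω ∂P, 0 ≤ g ω * (stoppedValue X τ ω - stoppedValue X σ ω)) :
    ∀ᵐ ω ∂P, g ω * (stoppedValue X τ ω - stoppedValue X σ ω) = 0 := by
  have := hQ.isProbabilityMeasure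
  -- Long positions need only the local martingale measure and non-negativity.
  have hpos : ∀ᵐ ω ∂P, ω ∈ {ω | 0 < g ω} → stoppedValue X τ ω = stoppedValue X σ ω := by
    refine hQ.ac_symm.ae_le (hQ.isLocalMartingale.stoppedValue_eq_of_ge hnn hσ hτ hστ hT
      (hg measurableSet_Ioi) (hQ.ac.ae_le ?_))
    filter_upwards [h0] with ω hω hgω
    exact sub_nonneg.1 (nonneg_of_mul_nonneg_right hω hgω)
  -- Short positions have no lower bound on their losses; here stickiness enters.
  have hneg : ∀ᵐ ω ∂P, ω ∈ {ω | g ω < 0} → stoppedValue X τ ω = stoppedValue X σ ω := by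
    refine hQ.ac_symm.ae_le (hQ.isLocalMartingale.stoppedValue_eq_of_le hσ hτ hστ hT
      (hg measurableSet_Iio) (hQ.ac.ae_le ?_))
    refine hS.le_stoppedValue hQ.isLocalMartingale.toIsAdaptedCadlag hσ hτ hT
      (hg measurableSet_Iio) ?_
    filter_upwards [h0] with ω hω hgω
    have hgω' : g ω < 0 := hgω
    by_contra! h
    exact absurd hω (not_le.2 (mul_neg_of_neg_of_pos hgω' (sub_pos.2 h)))
  filter_upwards [hpos, hneg] with ω h1 h2
  rcases lt_trichotomy (g ω) 0 with h | h | h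
  · rw [h2 h, sub_self, mul_zero]
  · rw [h, zero_mul]
  · rw [h1 h, sub_self, mul_zero]

end

end SimpleTrading

namespace SimpleTrading

noncomputable section

/-! ### Sorting finitely many times -/

section OrderStatistics

/-- The values of a finite family in increasing order, extended by `c` beyond its length. -/
def orderStatistic {α : Type*} [LinearOrder α] {N : ℕ} (c : α) (f : Fin N → α) (k : ℕ) : α :=
  if h : k < N then f (Tuple.sort f ⟨k, h⟩) else c

variable {α : Type*} [LinearOrder α] {N : ℕ} {c : α} {f : Fin N → α}

theorem orderStatistic_le (hf : ∀ i, f i ≤ c) (k : ℕ) : orderStatistic c f k ≤ c := by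
  rw [orderStatistic]
  split_ifs with h
  · exact hf _
  · exact le_rfl

theorem monotone_orderStatistic (hf : ∀ i, f i ≤ c) : Monotone (orderStatistic c f) := by
  intro a b hab
  by_cases hb : b < N
  · have ha : a < N := hab.trans_lt hb
    simp only [orderStatistic, dif_pos ha, dif_pos hb]
    exact Tuple.monotone_sort f (show (⟨a, ha⟩ : Fin N) ≤ ⟨b, hb⟩ from hab)
  · rw [orderStatistic.eq_1 c f b, dif_neg hb]
    exact orderStatistic_le hf a

theorem exists_orderStatistic_eq (c : α) (f : Fin N → α) (i : Fin N) :
    ∃ k < N, orderStatistic c f k = f i := by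
  refine ⟨(Tuple.sort f).symm i, ((Tuple.sort f).symm i).2, ?_⟩
  rw [orderStatistic, dif_pos ((Tuple.sort f).symm i).2]
  simp

/-- Every `f i` is itself some order statistic, so none lies strictly between two consecutive ones.
-/
theorem orderStatistic_succ_le (hf : ∀ i, f i ≤ c) {i : Fin N} {k : ℕ}
    (h : orderStatistic c f k < f i) : orderStatistic c f (k + 1) ≤ f i := by
  obtain ⟨j, -, hj⟩ := exists_orderStatistic_eq c f i
  rw [← hj] at h ⊢
  exact monotone_orderStatistic hf ((monotone_orderStatistic hf).reflect_lt h)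

theorem orderStatistic_zero_le (hf : ∀ i, f i ≤ c) (i : Fin N) : orderStatistic c f 0 ≤ f i := by
  obtain ⟨j, -, hj⟩ := exists_orderStatistic_eq c f i
  rw [← hj]
  exact monotone_orderStatistic hf (Nat.zero_le j)

/-- Counting eliminates the sorting permutation, which for random times depends on the outcome; the
count is visibly known at time `t`. -/
theorem orderStatistic_le_iff (k : ℕ) (hk : k < N) (t : α) :
    orderStatistic c f k ≤ t ↔ k < (Finset.univ.filter fun i => f i ≤ t).card := by
  have h : (Finset.univ.filter fun i => (f ∘ Tuple.sort f) i ≤ t).card =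
      (Finset.univ.filter fun i => f i ≤ t).card := by
    refine Finset.card_bijective (Tuple.sort f) (Tuple.sort f).bijective fun i => ?_
    simp
  rw [orderStatistic, dif_pos hk, ← h]
  exact (Tuple.lt_card_le_iff_apply_le_of_monotone (f := f ∘ Tuple.sort f) (a := t) (j := ⟨k, hk⟩)
    (Tuple.monotone_sort f)).symm

/-- Telescoping along the order statistics up to one of the values of the family. -/
theorem sum_orderStatistic (hf : ∀ i, f i ≤ c) (x : α → ℝ) (i : Fin N) :
    ∑ k ∈ Finset.range N, (if orderStatistic c f k < f i then
      x (orderStatistic c f (k + 1)) - x (orderStatistic c f k) else 0) =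
      -- Stopping the sequence at `f i` makes the sum telescope, since later summands vanish. The
      -- default `c` at index `N` supplies the last end point.
      x (f i) - x (orderStatistic c f 0) := by
  have h1 : ∀ k, (if orderStatistic c f k < f i then
      x (orderStatistic c f (k + 1)) - x (orderStatistic c f k) else 0) =
      x (min (orderStatistic c f (k + 1)) (f i)) - x (min (orderStatistic c f k) (f i)) := by
    intro k
    split_ifs with h
    · rw [min_eq_left (orderStatistic_succ_le hf h), min_eq_left h.le]
    · rw [not_lt] at h
      rw [min_eq_right h, min_eq_right (h.trans (monotone_orderStatistic hf (Nat.le_succ k))),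
        sub_self]
  simp_rw [h1]
  rw [Finset.sum_range_sub (fun k => x (min (orderStatistic c f k) (f i))),
    min_eq_left (orderStatistic_zero_le hf i), min_eq_right]
  rw [orderStatistic, dif_neg (lt_irrefl N)]
  exact hf i

end OrderStatistics

/-! ### From one period to arbitrary simple strategies -/

variable {Ω : Type*} {mΩ : MeasurableSpace Ω} {𝔽 : Filtration ℝ≥0 mΩ} {P Q : Measure Ω}
  {X : ℝ≥0 → Ω → ℝ}

/-- Order statistics of stopping times are stopping times. -/
theorem isStoppingTime_orderStatistic {N : ℕ} {τ : Fin N → Ω → WithTop ℝ≥0}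
    (hτ : ∀ i, IsStoppingTime 𝔽 (τ i)) (T : ℝ≥0) (k : ℕ) :
    IsStoppingTime 𝔽 fun ω => orderStatistic (T : WithTop ℝ≥0) (fun i => τ i ω) k := by
  by_cases hk : k < N
  · intro t
    simp_rw [orderStatistic_le_iff k hk, Finset.card_filter]
    have hm : Measurable[𝔽 t] fun ω => ∑ i, if τ i ω ≤ t then 1 else 0 :=
      Finset.measurable_sum _ fun i _ =>
        Measurable.ite (hτ i t) measurable_const measurable_const
    exact hm measurableSet_Ioi
  · have h : (fun ω => orderStatistic (T : WithTop ℝ≥0) (fun i => τ i ω) k) =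
        fun _ => (T : WithTop ℝ≥0) := by
      funext ω
      rw [orderStatistic, dif_neg hk]
    rw [h]
    exact isStoppingTime_const 𝔽 T

/-- A random variable known at `σ`, restricted to `σ ≤ τ`, is known at `τ`. -/
theorem measurable_indicator_le {σ τ : Ω → WithTop ℝ≥0} (hσ : IsStoppingTime 𝔽 σ)
    (hτ : IsStoppingTime 𝔽 τ) {g : Ω → ℝ} (hg : Measurable[hσ.measurableSpace] g) :
    Measurable[hτ.measurableSpace] ({ω | σ ω ≤ τ ω}.indicator g) := by
  have hle : MeasurableSet[hτ.measurableSpace] {ω | σ ω ≤ τ ω} :=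
    hσ.measurableSet_stopping_time_le hτ
  intro s hs
  have h1 : MeasurableSet[hτ.measurableSpace] (g ⁻¹' s ∩ {ω | σ ω ≤ τ ω}) :=
    (hσ.min hτ).measurableSpace_mono hτ (fun ω => min_le_right _ _) _
      (hσ.measurableSet_inter_le hτ _ (hg hs))
  by_cases h0 : (0 : ℝ) ∈ s
  · have : {ω | σ ω ≤ τ ω}.indicator g ⁻¹' s =
        (g ⁻¹' s ∩ {ω | σ ω ≤ τ ω}) ∪ {ω | σ ω ≤ τ ω}ᶜ := by
      ext ω
      by_cases h : ω ∈ {ω | σ ω ≤ τ ω}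
      · rw [Set.mem_preimage, Set.indicator_of_mem h]
        exact ⟨fun h1 => Or.inl ⟨h1, h⟩, fun h1 => h1.elim And.left fun h2 => absurd h h2⟩
      · rw [Set.mem_preimage, Set.indicator_of_notMem h]
        exact ⟨fun _ => Or.inr h, fun _ => h0⟩
    rw [this]
    exact h1.union hle.compl
  · have : {ω | σ ω ≤ τ ω}.indicator g ⁻¹' s = g ⁻¹' s ∩ {ω | σ ω ≤ τ ω} := by
      ext ω
      by_cases h : ω ∈ {ω | σ ω ≤ τ ω}
      · rw [Set.mem_preimage, Set.indicator_of_mem h]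
        exact ⟨fun h1 => ⟨h1, h⟩, And.left⟩
      · rw [Set.mem_preimage, Set.indicator_of_notMem h]
        exact ⟨fun h1 => absurd h1 h0, fun h1 => absurd h1.2 h⟩
    rw [this]
    exact h1

/-- There is no arbitrage along a finite increasing sequence of bounded stopping times. -/
theorem StaysClose.noArbitrage_multiPeriod (hS : StaysClose P 𝔽 X) (hnn : ∀ t ω, 0 ≤ X t ω)
    (hQ : IsELMM P Q 𝔽 X) {ρ : ℕ → Ω → WithTop ℝ≥0} (hρ : ∀ k, IsStoppingTime 𝔽 (ρ k))
    (hmono : Monotone ρ) {T : ℝ≥0} (hT : ∀ k ω, ρ k ω ≤ T) {h : ℕ → Ω → ℝ}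
    (hh : ∀ k, Measurable[(hρ k).measurableSpace] (h k)) (n : ℕ)
    (h0 : ∀ᵐ ω ∂P, 0 ≤ ∑ k ∈ Finset.range n,
      h k ω * (stoppedValue X (ρ (k + 1)) ω - stoppedValue X (ρ k) ω)) :
    ∀ᵐ ω ∂P, ∑ k ∈ Finset.range n,
      h k ω * (stoppedValue X (ρ (k + 1)) ω - stoppedValue X (ρ k) ω) = 0 := by
  have hX := hQ.isLocalMartingale.toIsAdaptedCadlag
  have hprog : IsStronglyProgressive 𝔽 X :=
    isStronglyProgressive_of_rightContinuous hX.adapted fun ω t => (hX.cadlag ω t).1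
  induction n with
  | zero => simp
  | succ n ih =>
    set V : Ω → ℝ := fun ω => ∑ k ∈ Finset.range n,
      h k ω * (stoppedValue X (ρ (k + 1)) ω - stoppedValue X (ρ k) ω) with hV
    have hVm : Measurable[(hρ n).measurableSpace] V := by
      refine Finset.measurable_sum _ fun k hk => ?_
      have hkn : k + 1 ≤ n := Finset.mem_range.1 hk
      have m1 := (hρ k).measurableSpace_mono (hρ n) (hmono ((Nat.le_succ k).trans hkn))
      have m2 := (hρ (k + 1)).measurableSpace_mono (hρ n) (hmono hkn)
      exact ((hh k).mono m1 le_rfl).mul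
        (((measurable_stoppedValue hprog (hρ (k + 1))).mono m2 le_rfl).sub
          ((measurable_stoppedValue hprog (hρ k)).mono m1 le_rfl))
    simp_rw [Finset.sum_range_succ] at h0 ⊢
    have hstep : ρ n ≤ ρ (n + 1) := hmono (Nat.le_succ n)
    -- Trade in the last period only where the earlier gains `V` are negative. There the last gain
    -- must be at least `-V > 0`, so one-period no-arbitrage makes `{V < 0}` null.
    have hg : Measurable[(hρ n).measurableSpace] ({ω | V ω < 0}.indicator (h n)) :=
      (hh n).indicator (hVm measurableSet_Iio)
    have h1 := hS.noArbitrage_onePeriod hnn hQ (hρ n) (hρ (n + 1)) hstep (hT (n + 1)) hg <| by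
      filter_upwards [h0] with ω hω
      by_cases hneg : V ω < 0
      · rw [Set.indicator_of_mem (show ω ∈ {ω | V ω < 0} from hneg)]
        have : 0 ≤ V ω + h n ω * (stoppedValue X (ρ (n + 1)) ω - stoppedValue X (ρ n) ω) := hω
        linarith
      · rw [Set.indicator_of_notMem (show ω ∉ {ω | V ω < 0} from hneg), zero_mul]
    have hVnn : ∀ᵐ ω ∂P, 0 ≤ V ω := by
      filter_upwards [h0, h1] with ω hω hω1
      by_contra! hneg
      rw [Set.indicator_of_mem (show ω ∈ {ω | V ω < 0} from hneg)] at hω1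
      rw [hω1, add_zero] at hω
      exact absurd hneg (not_lt.2 hω)
    have hV0 := ih hVnn
    have h2 := hS.noArbitrage_onePeriod hnn hQ (hρ n) (hρ (n + 1)) hstep (hT (n + 1)) (hh n) <| by
      filter_upwards [h0, hV0] with ω hω hω1
      rwa [hω1, zero_add] at hω
    filter_upwards [hV0, h2] with ω hω1 hω2
    rw [hω1, hω2, add_zero]

/-- There is no arbitrage in finite sums of trades, each of which holds a position known at the
beginning of a stochastic interval until its end; the intervals may overlap. -/
theorem StaysClose.noArbitrage_trades (hS : StaysClose P 𝔽 X) (hnn : ∀ t ω, 0 ≤ X t ω)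
    (hQ : IsELMM P Q 𝔽 X) {κ : Type*} [Fintype κ] {a b : κ → Ω → WithTop ℝ≥0}
    (ha : ∀ e, IsStoppingTime 𝔽 (a e)) (hb : ∀ e, IsStoppingTime 𝔽 (b e))
    (hab : ∀ e, a e ≤ b e) {T : ℝ≥0} (hT : ∀ e ω, b e ω ≤ T) {g : κ → Ω → ℝ}
    (hg : ∀ e, Measurable[(ha e).measurableSpace] (g e))
    (h0 : ∀ᵐ ω ∂P, 0 ≤ ∑ e, g e ω * (stoppedValue X (b e) ω - stoppedValue X (a e) ω)) :
    ∀ᵐ ω ∂P, ∑ e, g e ω * (stoppedValue X (b e) ω - stoppedValue X (a e) ω) = 0 := by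
  let N := Fintype.card (κ ⊕ κ)
  let eq : κ ⊕ κ ≃ Fin N := Fintype.equivFin _
  let τ : Fin N → Ω → WithTop ℝ≥0 := fun i => Sum.elim a b (eq.symm i)
  have hτ : ∀ i, IsStoppingTime 𝔽 (τ i) := by
    intro i
    rcases h : eq.symm i with e | e <;> simp only [τ, h, Sum.elim_inl, Sum.elim_inr]
    exacts [ha e, hb e]
  have hτT : ∀ ω i, τ i ω ≤ T := by
    intro ω i
    rcases h : eq.symm i with e | e <;> simp only [τ, h, Sum.elim_inl, Sum.elim_inr]
    exacts [(hab e ω).trans (hT e ω), hT e ω]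
  have hτa : ∀ e, τ (eq (Sum.inl e)) = a e := fun e => by simp [τ]
  have hτb : ∀ e, τ (eq (Sum.inr e)) = b e := fun e => by simp [τ]
  let ρ : ℕ → Ω → WithTop ℝ≥0 := fun k ω => orderStatistic (T : WithTop ℝ≥0) (fun i => τ i ω) k
  have hρ : ∀ k, IsStoppingTime 𝔽 (ρ k) := isStoppingTime_orderStatistic hτ T
  -- The position in the `k`-th period is the sum of the `g e` over the trades open at `ρ k`, those
  -- with `a e ≤ ρ k < b e`.
  let h : ℕ → Ω → ℝ := fun k ω => ∑ e, {ω | b e ω ≤ ρ k ω}ᶜ.indicator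
    ({ω | a e ω ≤ ρ k ω}.indicator (g e)) ω
  have hh : ∀ k, Measurable[(hρ k).measurableSpace] (h k) := by
    intro k
    refine Finset.measurable_sum _ fun e _ => ?_
    exact (measurable_indicator_le (ha e) (hρ k) (hg e)).indicator
      ((hb e).measurableSet_stopping_time_le (hρ k)).compl
  have hgain : ∀ ω, ∑ k ∈ Finset.range N,
      h k ω * (stoppedValue X (ρ (k + 1)) ω - stoppedValue X (ρ k) ω) =
      ∑ e, g e ω * (stoppedValue X (b e) ω - stoppedValue X (a e) ω) := by
    intro ω
    have ht : ∀ i, ∑ k ∈ Finset.range N, (if ρ k ω < τ i ω then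
        stoppedValue X (ρ (k + 1)) ω - stoppedValue X (ρ k) ω else 0) =
        stoppedValue X (τ i) ω - stoppedValue X (ρ 0) ω := fun i =>
      sum_orderStatistic (hτT ω) (fun s => X s.untopA ω) i
    have he : ∀ e, stoppedValue X (b e) ω - stoppedValue X (a e) ω =
        ∑ k ∈ Finset.range N, ((if ρ k ω < b e ω then
          stoppedValue X (ρ (k + 1)) ω - stoppedValue X (ρ k) ω else 0) -
          if ρ k ω < a e ω then
            stoppedValue X (ρ (k + 1)) ω - stoppedValue X (ρ k) ω else 0) := by
      intro e
      have h1 := ht (eq (Sum.inl e))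
      have h2 := ht (eq (Sum.inr e))
      rw [hτa] at h1
      rw [hτb] at h2
      rw [Finset.sum_sub_distrib, h1, h2, sub_sub_sub_cancel_right]
    simp_rw [he, h, Finset.mul_sum, Finset.sum_mul]
    rw [Finset.sum_comm]
    refine Finset.sum_congr rfl fun e _ => Finset.sum_congr rfl fun k _ => ?_
    have hle := hab e ω
    by_cases h1 : a e ω ≤ ρ k ω
    · have m1 : ω ∈ {ω | a e ω ≤ ρ k ω} := h1
      rw [if_neg (not_lt.2 h1), sub_zero]
      by_cases h2 : b e ω ≤ ρ k ω
      · have m2 : ω ∉ {ω | b e ω ≤ ρ k ω}ᶜ := fun h => h h2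
        rw [Set.indicator_of_notMem m2, if_neg (not_lt.2 h2), zero_mul, mul_zero]
      · have m2 : ω ∈ {ω | b e ω ≤ ρ k ω}ᶜ := h2
        rw [Set.indicator_of_mem m2, Set.indicator_of_mem m1, if_pos (not_le.1 h2)]
    · have m1 : ω ∉ {ω | a e ω ≤ ρ k ω} := h1
      have h2 : ¬ b e ω ≤ ρ k ω := fun h => h1 (hle.trans h)
      have m2 : ω ∈ {ω | b e ω ≤ ρ k ω}ᶜ := h2
      rw [Set.indicator_of_mem m2, Set.indicator_of_notMem m1, if_pos (not_le.1 h2),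
        if_pos (not_le.1 h1), sub_self, zero_mul, mul_zero]
  have key := hS.noArbitrage_multiPeriod hnn hQ hρ
    (fun j k hjk ω => monotone_orderStatistic (hτT ω) hjk)
    (fun k ω => orderStatistic_le (hτT ω) k) hh N
  simp_rw [hgain] at key
  exact key h0

/-- Stickiness at deterministic times and an equivalent local martingale measure rule out
arbitrage in simple strategies. -/
theorem StaysClose.noArbitrage (hS : StaysClose P 𝔽 X) (hnn : ∀ t ω, 0 ≤ X t ω)
    (hQ : IsELMM P Q 𝔽 X) : NoArbitrage P 𝔽 X := by
  -- The integrand is discarded: the argument covers the gain of every representation, so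
  -- independence of the representation plays no role.
  rintro H - Y ⟨V, W, -, rfl⟩ h0
  choose cV hcV using V.bounded
  choose cW hcW using W.bounded
  let T : ℝ≥0 := ∑ j, cV j + ∑ j, cW j
  have hVT : ∀ j, cV j ≤ T := fun j =>
    (Finset.single_le_sum (fun _ _ => zero_le) (Finset.mem_univ j)).trans le_self_add
  have hWT : ∀ j, cW j ≤ T := fun j =>
    (Finset.single_le_sum (fun _ _ => zero_le) (Finset.mem_univ j)).trans le_add_self
  let a : Fin V.m ⊕ Fin W.m → Ω → WithTop ℝ≥0 :=
    Sum.elim (fun j => V.τ j.castSucc) fun j => W.τ j.castSucc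
  let b : Fin V.m ⊕ Fin W.m → Ω → WithTop ℝ≥0 :=
    Sum.elim (fun j => V.τ j.succ) fun j => W.τ j.succ
  let g : Fin V.m ⊕ Fin W.m → Ω → ℝ := Sum.elim V.g fun j ω => -W.g j ω
  have ha : ∀ e, IsStoppingTime 𝔽 (a e) := by
    rintro (j | j)
    exacts [V.isStoppingTime _, W.isStoppingTime _]
  have hb : ∀ e, IsStoppingTime 𝔽 (b e) := by
    rintro (j | j)
    exacts [V.isStoppingTime _, W.isStoppingTime _]
  have hab : ∀ e, a e ≤ b e := by
    rintro (j | j) ω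
    exacts [V.mono ω j.castSucc_lt_succ.le, W.mono ω j.castSucc_lt_succ.le]
  have hT : ∀ e ω, b e ω ≤ T := by
    rintro (j | j) ω
    exacts [(hcV _ ω).trans (WithTop.coe_le_coe.2 (hVT _)),
      (hcW _ ω).trans (WithTop.coe_le_coe.2 (hWT _))]
  have hg : ∀ e, Measurable[(ha e).measurableSpace] (g e) := by
    rintro (j | j)
    exacts [V.g_measurable j, (W.g_measurable j).neg]
  have hgain : ∀ ω, ∑ e, g e ω * (stoppedValue X (b e) ω - stoppedValue X (a e) ω) =
      (V.gain X - W.gain X) ω := by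
    intro ω
    simp only [Fintype.sum_sum_type, a, b, g, Sum.elim_inl, Sum.elim_inr, Pi.sub_apply,
      RestrictedStrategy.gain, neg_mul, Finset.sum_neg_distrib, sub_eq_add_neg]
  have key := hS.noArbitrage_trades hnn hQ ha hb hab hT hg
  simp_rw [hgain] at key
  exact key h0

/-- A sticky process satisfies stickiness at deterministic times. -/
theorem IsSticky.staysClose (hS : IsSticky P 𝔽 X) : StaysClose P 𝔽 X := by
  classical
  intro q u ε hε B hB hω
  by_contra hPB
  let τ : Ω → WithTop ℝ≥0 := fun ω => if ω ∈ B then (q : WithTop ℝ≥0) else ⊤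
  have hτB : ∀ ω ∈ B, τ ω = q := fun ω h => if_pos h
  have hτlt : ∀ ω (t : ℝ≥0), τ ω ≤ t → ω ∈ B ∧ q ≤ t := by
    intro ω t h
    by_cases hωB : ω ∈ B
    · rw [hτB ω hωB] at h
      exact ⟨hωB, WithTop.coe_le_coe.1 h⟩
    · simp only [τ, if_neg hωB, top_le_iff, WithTop.coe_ne_top] at h
  have hτ : IsStoppingTime 𝔽 τ := by
    intro t
    by_cases hqt : q ≤ t
    · have : {ω | τ ω ≤ t} = B := by
        ext ω
        refine ⟨fun h => (hτlt ω t h).1, fun h => ?_⟩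
        rw [Set.mem_ofPred_eq, hτB ω h]
        exact WithTop.coe_le_coe.2 hqt
      rw [this]
      exact 𝔽.mono hqt _ hB
    · have : {ω | τ ω ≤ t} = ∅ := by
        ext ω
        exact ⟨fun h => hqt (hτlt ω t h).2, fun h => h.elim⟩
      rw [this]
      exact @MeasurableSet.empty _ (𝔽 t)
  -- The extra `1` makes the horizon positive and strictly later than `q`, also for `u = 0`.
  have hqT : (q : WithTop ℝ≥0) < (q + u + 1 : ℝ≥0) := by
    refine WithTop.coe_lt_coe.2 (lt_of_le_of_lt le_self_add (lt_add_of_pos_right _ one_pos))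
  have h1 : 0 < P {ω | τ ω < (q + u + 1 : ℝ≥0)} := by
    refine (pos_iff_ne_zero.2 hPB).trans_le (measure_mono fun ω h => ?_)
    rw [Set.mem_ofPred_eq, hτB ω h]
    exact hqT
  refine (hS (q + u + 1) (by positivity) ε hε τ hτ h1).ne' (measure_mono_null ?_ hω)
  rintro ω ⟨h2, h3⟩ h4
  have hωB : ω ∈ B := (hτlt ω _ h2.le).1
  obtain ⟨s, hs, h5⟩ := h4 hωB
  refine absurd h3 (not_lt.2 ?_)
  have h6 : stoppedValue X τ ω = X q ω := by rw [stoppedValue, hτB ω hωB, untopA_coe]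
  rw [h6]
  refine (ENNReal.ofReal_le_ofReal h5).trans
    (le_iSup₂_of_le (q + s) ⟨?_, ?_⟩ le_rfl)
  · rw [hτB ω hωB]
    exact WithTop.coe_le_coe.2 le_self_add
  · exact (add_le_add_right hs q).trans le_self_add

end

end SimpleTrading

namespace SimpleTrading

noncomputable section

/-! ### Path events read off countably many times -/

section Paths

/-- A dense sequence of times beginning with `0`. -/
def clock : ℕ → ℝ≥0
  | 0 => 0
  | n + 1 => TopologicalSpace.denseSeq ℝ≥0 n

theorem exists_clock_mem {a b : ℝ≥0} (h : a < b) : ∃ i, a < clock i ∧ clock i < b := by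
  obtain ⟨_, ⟨n, rfl⟩, hn⟩ := (TopologicalSpace.denseRange_denseSeq ℝ≥0).exists_between h
  exact ⟨n + 1, hn⟩

/-- The values of a path along `clock`. -/
def sample (y : ℝ≥0 → ℝ) : ℕ → ℝ := fun i => y (clock i)

theorem measurable_sample : Measurable sample :=
  measurable_pi_lambda _ fun _ => measurable_pi_apply _

/-- Sampled paths which remain strictly inside the `ε`-ball around their initial value, uniformly
before time `u`. -/
def stayed (ε : ℝ) (u : ℝ≥0) : Set (ℕ → ℝ) :=
  {z | ∃ m : ℕ, ∀ i, clock i < u → |z i - z 0| ≤ ε - 1 / ((m : ℝ) + 1)}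

/-- The path `y` returns to its initial value at the time `s ≥ δ`, having remained strictly
inside the `ε`-ball around it, uniformly before `s`. -/
def Returns (δ : ℝ≥0) (ε : ℝ) (y : ℝ≥0 → ℝ) (s : ℝ≥0) : Prop :=
  δ ≤ s ∧ y s = y 0 ∧ ∃ m : ℕ, ∀ r < s, |y r - y 0| ≤ ε - 1 / ((m : ℝ) + 1)

/-- The pairs of a sampled path and a time corresponding to `Returns`. -/
def returnSet (δ : ℝ≥0) (ε : ℝ) : Set ((ℕ → ℝ) × ℝ≥0) :=
  {p | δ ≤ p.2 ∧ (∀ n : ℕ, ∃ m : ℕ, ∀ i, p.2 < clock i → clock i < p.2 + 1 / ((m : ℝ≥0) + 1) →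
    |p.1 i - p.1 0| ≤ 1 / ((n : ℝ) + 1)) ∧
    ∃ m : ℕ, ∀ i, clock i < p.2 → |p.1 i - p.1 0| ≤ ε - 1 / ((m : ℝ) + 1)}

theorem measurableSet_stayed (ε : ℝ) (u : ℝ≥0) : MeasurableSet (stayed ε u) := by
  have h : stayed ε u = ⋃ m : ℕ, ⋂ i, {z | clock i < u → |z i - z 0| ≤ ε - 1 / ((m : ℝ) + 1)} := by
    ext z
    simp [stayed]
  rw [h]
  refine MeasurableSet.iUnion fun m => MeasurableSet.iInter fun i => ?_
  refine (MeasurableSet.const (clock i < u)).imp (measurableSet_le ?_ measurable_const)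
  exact ((measurable_pi_apply i).sub (measurable_pi_apply 0)).norm

theorem measurableSet_abs_sub_le (i : ℕ) (c : ℝ) :
    MeasurableSet {p : (ℕ → ℝ) × ℝ≥0 | |p.1 i - p.1 0| ≤ c} :=
  measurableSet_le (((measurable_pi_apply i).comp measurable_fst).sub
    ((measurable_pi_apply 0).comp measurable_fst)).norm measurable_const

theorem measurableSet_returnSet (δ : ℝ≥0) (ε : ℝ) : MeasurableSet (returnSet δ ε) := by
  have h : returnSet δ ε = {p | δ ≤ p.2} ∩ ((⋂ n : ℕ, ⋃ m : ℕ, ⋂ i,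
      ({p : (ℕ → ℝ) × ℝ≥0 | p.2 < clock i}ᶜ ∪ ({p | clock i < p.2 + 1 / ((m : ℝ≥0) + 1)}ᶜ ∪
        {p | |p.1 i - p.1 0| ≤ 1 / ((n : ℝ) + 1)}))) ∩
      ⋃ m : ℕ, ⋂ i, ({p : (ℕ → ℝ) × ℝ≥0 | clock i < p.2}ᶜ ∪
        {p | |p.1 i - p.1 0| ≤ ε - 1 / ((m : ℝ) + 1)})) := by
    ext p
    simp only [returnSet, Set.mem_ofPred_eq, Set.mem_inter_iff, Set.mem_iInter, Set.mem_iUnion,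
      Set.mem_union, Set.mem_compl_iff, imp_iff_not_or]
  rw [h]
  refine (measurableSet_le measurable_const measurable_snd).inter
    ((MeasurableSet.iInter fun n => MeasurableSet.iUnion fun m => MeasurableSet.iInter fun i =>
      ?_).inter (MeasurableSet.iUnion fun m => MeasurableSet.iInter fun i => ?_))
  · exact (measurableSet_lt measurable_snd measurable_const).compl.union
      ((measurableSet_lt measurable_const (measurable_snd.add_const _)).compl.union
        (measurableSet_abs_sub_le i _))
  · exact (measurableSet_lt measurable_const measurable_snd).compl.union
      (measurableSet_abs_sub_le i _)

variable {y : ℝ≥0 → ℝ} {ε : ℝ} {δ s t u : ℝ≥0}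

theorem mem_of_forall_clock_mem (hy : ContinuousWithinAt y (Set.Ici s) s) {C : Set ℝ}
    (hC : IsClosed C) (hsu : s < u) (h : ∀ i, s < clock i → clock i < u → y (clock i) ∈ C) :
    y s ∈ C := by
  by_contra hs
  have h1 : ∀ᶠ r in 𝓝[≥] s, y r ∈ Cᶜ := hy.tendsto.eventually (hC.isOpen_compl.mem_nhds hs)
  obtain ⟨v, hv, hv'⟩ := (mem_nhdsGE_iff_exists_Ico_subset' hsu).1 h1
  obtain ⟨i, hi1, hi2⟩ := exists_clock_mem (lt_min hsu hv)
  exact hv' ⟨hi1.le, hi2.trans_le (min_le_right _ _)⟩ (h i hi1 (hi2.trans_le (min_le_left _ _)))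

/-- A closed condition passes from a dense set of times to all times by right-continuity; a strict
inequality would not. This is why closeness is expressed with margins `1 / (m + 1)`. -/
theorem forall_clock_abs_le_iff (hy : ∀ t, ContinuousWithinAt y (Set.Ici t) t) (c : ℝ) :
    (∀ i, clock i < u → |y (clock i) - y 0| ≤ c) ↔ ∀ s < u, |y s - y 0| ≤ c := by
  refine ⟨fun h s hs => ?_, fun h i hi => h _ hi⟩
  have hC : IsClosed {x : ℝ | |x - y 0| ≤ c} :=
    isClosed_le ((continuous_id.sub continuous_const).abs) continuous_const
  exact mem_of_forall_clock_mem (hy s) hC hs fun i _ hi => h i hi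

theorem sample_mem_stayed_iff (hy : ∀ t, ContinuousWithinAt y (Set.Ici t) t) :
    sample y ∈ stayed ε u ↔ ∃ m : ℕ, ∀ s < u, |y s - y 0| ≤ ε - 1 / ((m : ℝ) + 1) :=
  exists_congr fun _ => forall_clock_abs_le_iff hy _

/-- The time `s` need not belong to the clock, so `y s = y 0` is encoded as a limit along clock
times decreasing to `s`. -/
theorem sample_mem_returnSet_iff (hy : ∀ t, ContinuousWithinAt y (Set.Ici t) t) :
    (sample y, s) ∈ returnSet δ ε ↔ Returns δ ε y s := by
  refine and_congr Iff.rfl (and_congr ?_ (exists_congr fun _ => forall_clock_abs_le_iff hy _))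
  constructor
  · intro h
    rw [← sub_eq_zero, ← abs_nonpos_iff]
    refine le_of_forall_pos_le_add fun η hη => ?_
    obtain ⟨n, hn⟩ := exists_nat_one_div_lt hη
    obtain ⟨m, hm⟩ := h n
    have hC : IsClosed {x : ℝ | |x - y 0| ≤ 1 / ((n : ℝ) + 1)} :=
      isClosed_le ((continuous_id.sub continuous_const).abs) continuous_const
    have h1 : |y s - y 0| ≤ 1 / ((n : ℝ) + 1) :=
      mem_of_forall_clock_mem (hy s) hC
        (lt_add_of_pos_right s (by positivity : 0 < 1 / ((m : ℝ≥0) + 1))) hm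
    linarith
  · intro h n
    have h1 : ∀ᶠ r in 𝓝[≥] s, |y r - y 0| < 1 / ((n : ℝ) + 1) := by
      have h2 : Tendsto (fun r => |y r - y 0|) (𝓝[≥] s) (𝓝 |y s - y 0|) :=
        ((hy s).tendsto.sub_const _).abs
      rw [h, sub_self, abs_zero] at h2
      exact h2.eventually (Iio_mem_nhds (by positivity))
    obtain ⟨v, hv, hv'⟩ := (mem_nhdsGE_iff_exists_Ico_subset' (lt_add_one s)).1 h1
    obtain ⟨m, hm⟩ := exists_nat_one_div_lt (tsub_pos_of_lt (show s < v from hv))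
    refine ⟨m, fun i hi1 hi2 => (hv' ⟨hi1.le, hi2.trans ?_⟩).le⟩
    exact (add_lt_add_right hm s).trans_eq (add_tsub_cancel_of_le (le_of_lt hv))

/-- Stopping a path does not affect whether it returns before the time of stopping. -/
theorem returns_min_iff (hs : s < t) : Returns δ ε (fun r => y (min r t)) s ↔ Returns δ ε y s := by
  unfold Returns
  simp only [min_eq_left hs.le, min_eq_left (zero_le (a := t))]
  refine and_congr Iff.rfl (and_congr Iff.rfl (exists_congr fun m => forall₂_congr fun r hr => ?_))
  rw [min_eq_left (hr.trans hs).le]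

/-- If a right-continuous path returns at all, there is a first time at which it does. -/
theorem Returns.exists_first (hy : ∀ t, ContinuousWithinAt y (Set.Ici t) t)
    (hs : Returns δ ε y s) : ∃ ρ, Returns δ ε y ρ ∧ ∀ r, Returns δ ε y r → ρ ≤ r := by
  let S : Set ℝ≥0 := {r | Returns δ ε y r}
  have hne : S.Nonempty := ⟨s, hs⟩
  have hle : ∀ r, Returns δ ε y r → sInf S ≤ r := fun r hr => csInf_le (OrderBot.bddBelow S) hr
  refine ⟨sInf S, ⟨le_csInf hne fun r hr => hr.1, ?_, ?_⟩, hle⟩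
  · by_contra h
    have h1 : ∀ᶠ r in 𝓝[≥] sInf S, y r ∈ ({y 0} : Set ℝ)ᶜ :=
      (hy _).tendsto.eventually (isOpen_compl_singleton.mem_nhds h)
    obtain ⟨v, hv, hv'⟩ := (mem_nhdsGE_iff_exists_Ico_subset' (lt_add_one _)).1 h1
    obtain ⟨r, hr, hrv⟩ := exists_lt_of_csInf_lt hne hv
    exact hv' ⟨hle r hr, hrv⟩ hr.2.1
  -- One return at `s` already controls the path before `s`, hence before the infimum, with the same
  -- margin.
  · obtain ⟨m, hm⟩ := hs.2.2
    exact ⟨m, fun r hr => hm r (hr.trans_le (hle s hs))⟩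

/-- A path which returns and afterwards again remains in the ball for the time `v` remains in
the ball for the time `δ + v`. -/
theorem Returns.stayed_add (hy : ∀ t, ContinuousWithinAt y (Set.Ici t) t)
    {ρ v : ℝ≥0} (hρ : Returns δ ε y ρ) (hpost : sample (fun r => y (ρ + r)) ∈ stayed ε v)
    (hyρ : ∀ t, ContinuousWithinAt (fun r => y (ρ + r)) (Set.Ici t) t) :
    sample y ∈ stayed ε (δ + v) := by
  obtain ⟨m₁, hm₁⟩ := hρ.2.2
  obtain ⟨m₂, hm₂⟩ := (sample_mem_stayed_iff hyρ).1 hpost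
  refine (sample_mem_stayed_iff hy).2 ⟨max m₁ m₂, fun r hr => ?_⟩
  rcases lt_or_ge r ρ with h | h
  · refine (hm₁ r h).trans ?_
    gcongr
    exact le_max_left _ _
  · have h1 : r - ρ < v := by
      rw [tsub_lt_iff_left h]
      exact hr.trans_le (add_le_add_left hρ.1 v)
    have h2 := hm₂ (r - ρ) h1
    simp only [add_zero, add_tsub_cancel_of_le h, hρ.2.1] at h2
    refine h2.trans ?_
    gcongr
    exact le_max_right _ _

theorem stayed_zero (ε : ℝ) : stayed ε 0 = Set.univ :=
  Set.eq_univ_of_forall fun _ => ⟨0, fun _ hi => absurd hi not_lt_zero⟩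

theorem stayed_anti (ε : ℝ) {u v : ℝ≥0} (h : u ≤ v) : stayed ε v ⊆ stayed ε u := by
  rintro z ⟨m, hm⟩
  exact ⟨m, fun i hi => hm i (hi.trans_le h)⟩

/-- The existence of a return time ranges over uncountably many times: a projection, which need not
be Borel. -/
theorem analyticSet_image_returnSet (δ : ℝ≥0) (ε : ℝ) {I : Set ℝ≥0} (hI : MeasurableSet I) :
    AnalyticSet (Prod.fst '' (returnSet δ ε ∩ Set.univ ×ˢ I)) :=
  ((measurableSet_returnSet δ ε).inter (MeasurableSet.univ.prod hI)).analyticSet_image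
    measurable_fst

end Paths

end

end SimpleTrading

namespace SimpleTrading

noncomputable section

/-! ### Strong Markov processes with regular points -/

variable {Ω : Type*} {mΩ : MeasurableSpace Ω} {𝔽 : Filtration ℝ≥0 mΩ} {P : Measure Ω}
  {X : ℝ≥0 → Ω → ℝ}

theorem IsAdaptedCadlag.continuousWithinAt_add (hX : IsAdaptedCadlag 𝔽 X) (ω : Ω) (q t : ℝ≥0) :
    ContinuousWithinAt (fun r => X (q + r) ω) (Set.Ici t) t :=
  ContinuousWithinAt.comp (g := fun t => X t ω) (f := fun r => q + r) (hX.cadlag ω (q + t)).1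
    (continuous_const.add continuous_id).continuousWithinAt fun _ hr => add_le_add_right hr q

/-- The first return time after `δ` of the process from its value at `q`, while remaining in the
`ε`-ball, agrees a.s. with a stopping time. -/
theorem exists_isStoppingTime_first_return [IsFiniteMeasure P] (hF : 𝔽.IsRightContinuous)
    (hX : IsAdaptedCadlag 𝔽 X) (q δ : ℝ≥0) (ε : ℝ) :
    ∃ κ : Ω → WithTop ℝ≥0, IsStoppingTime 𝔽 κ ∧ (∀ ω, q ≤ κ ω) ∧
      ∀ᵐ ω ∂P, ((∃ s, Returns δ ε (fun r => X (q + r) ω) s) → κ ω < ⊤) ∧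
        (κ ω < ⊤ → ∃ ρ : ℝ≥0, κ ω = (q + ρ : ℝ≥0) ∧ Returns δ ε (fun r => X (q + r) ω) ρ) := by
  classical
  -- The path from `q` on, frozen at `clock i`, is known at `q + clock i`, and freezing does not
  -- affect returns before `clock i`.
  let Φ : ℕ → Ω → ℕ → ℝ := fun i ω => sample fun r => X (q + min r (clock i)) ω
  have hΦ : ∀ i, Measurable[𝔽 (q + clock i)] (Φ i) := fun i =>
    @measurable_pi_lambda _ _ _ (𝔽 (q + clock i)) _ _ fun j =>
      (hX.adapted _).mono (𝔽.mono (add_le_add_right (min_le_right _ _) q)) le_rfl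
  have hΦiff : ∀ i ω, Φ i ω ∈ Prod.fst '' (returnSet δ ε ∩ Set.univ ×ˢ Set.Iio (clock i)) ↔
      ∃ s < clock i, Returns δ ε (fun r => X (q + r) ω) s := by
    intro i ω
    have hc : ∀ t, ContinuousWithinAt (fun r => X (q + min r (clock i)) ω) (Set.Ici t) t :=
      fun t => ContinuousWithinAt.comp (g := fun r => X (q + r) ω)
        (f := fun r => min r (clock i)) (hX.continuousWithinAt_add ω q (min t (clock i)))
        (continuous_id.min continuous_const).continuousWithinAt
        fun r hr => Set.mem_Ici.2 (min_le_min_right _ hr)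
    constructor
    · rintro ⟨⟨z, s⟩, ⟨h1, -, h2⟩, h3⟩
      have h3' : z = Φ i ω := h3
      have h2' : s < clock i := h2
      rw [h3'] at h1
      exact ⟨s, h2', (returns_min_iff (y := fun r => X (q + r) ω) h2').1
        ((sample_mem_returnSet_iff hc).1 h1)⟩
    · rintro ⟨s, hs, h⟩
      exact ⟨(Φ i ω, s), ⟨(sample_mem_returnSet_iff hc).2
        ((returns_min_iff (y := fun r => X (q + r) ω) hs).2 h), trivial, hs⟩, rfl⟩
  choose C D hCA hAD hC hD hae using fun i => exists_measurableSet_between_analyticSet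
    (P.map (Φ i)) (analyticSet_image_returnSet δ ε (measurableSet_Iio (a := clock i)))
  -- Outside a null set, `Φ i ω ∈ C i` means a return before `clock i`; the infimum of such clock
  -- times is the first return time.
  let κ : Ω → WithTop ℝ≥0 := fun ω =>
    ⨅ i, if Φ i ω ∈ C i then ((q + clock i : ℝ≥0) : WithTop ℝ≥0) else ⊤
  have hκlt : ∀ ω (j : WithTop ℝ≥0), κ ω < j ↔
      ∃ i, Φ i ω ∈ C i ∧ ((q + clock i : ℝ≥0) : WithTop ℝ≥0) < j := by
    intro ω j
    rw [iInf_lt_iff]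
    refine exists_congr fun i => ?_
    split_ifs with h
    · exact ⟨fun h1 => ⟨h, h1⟩, And.right⟩
    · exact ⟨fun h1 => absurd h1 not_top_lt, fun h1 => absurd h1.1 h⟩
  have hκ : IsStoppingTime 𝔽 κ := by
    -- The infimum directly controls only `{κ < t}`; right-continuity of the filtration does the
    -- rest.
    refine isStoppingTime_of_measurableSet_lt_of_isRightContinuous fun t => ?_
    have h : {ω | κ ω < t} = ⋃ i, ⋃ _ : q + clock i < t, Φ i ⁻¹' C i := by
      ext ω
      simp only [Set.mem_ofPred_eq, hκlt, Set.mem_iUnion, Set.mem_preimage, exists_prop,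
        WithTop.coe_lt_coe, and_comm]
    rw [h]
    exact MeasurableSet.iUnion fun i => MeasurableSet.iUnion fun hi =>
      𝔽.mono hi.le _ (hΦ i (hC i))
  refine ⟨κ, hκ, fun ω => le_iInf fun i => ?_, ?_⟩
  · split_ifs
    · exact WithTop.coe_le_coe.2 le_self_add
    · exact le_top
  have hae' : ∀ᵐ ω ∂P, ∀ i, Φ i ω ∈ D i → Φ i ω ∈ C i := ae_all_iff.2 fun i =>
    ae_of_ae_map ((hΦ i).mono (𝔽.le _) le_rfl).aemeasurable (hae i)
  filter_upwards [hae'] with ω hω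
  have hCiff : ∀ i, Φ i ω ∈ C i ↔ ∃ s < clock i, Returns δ ε (fun r => X (q + r) ω) s := fun i =>
    ⟨fun h => (hΦiff i ω).1 (hCA i h), fun h => hω i (hAD i ((hΦiff i ω).2 h))⟩
  constructor
  · rintro ⟨s, hs⟩
    obtain ⟨i, hi, -⟩ := exists_clock_mem (lt_add_one s)
    exact (hκlt ω ⊤).2 ⟨i, (hCiff i).2 ⟨s, hi, hs⟩, WithTop.coe_lt_top _⟩
  · intro h
    obtain ⟨i, hi, -⟩ := (hκlt ω ⊤).1 h
    obtain ⟨s, -, hs⟩ := (hCiff i).1 hi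
    obtain ⟨ρ, hρ, hρmin⟩ := hs.exists_first (hX.continuousWithinAt_add ω q)
    refine ⟨ρ, eq_of_forall_gt_iff fun j => ?_, hρ⟩
    rw [hκlt]
    constructor
    · rintro ⟨i, hi, hj⟩
      obtain ⟨s, hsi, hs⟩ := (hCiff i).1 hi
      refine lt_of_le_of_lt (WithTop.coe_le_coe.2 (add_le_add_right ?_ q)) hj
      exact (hρmin s hs).trans hsi.le
    · intro hj
      obtain ⟨v, hv, hvj⟩ : ∃ v : ℝ≥0, ρ < v ∧ ((q + v : ℝ≥0) : WithTop ℝ≥0) ≤ j := by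
        rcases eq_or_ne j ⊤ with rfl | hj'
        · exact ⟨ρ + 1, lt_add_one ρ, le_top⟩
        · obtain ⟨t, rfl⟩ := WithTop.ne_top_iff_exists.1 hj'
          have ht : q + ρ < t := WithTop.coe_lt_coe.1 hj
          have hqt : q ≤ t := le_self_add.trans ht.le
          refine ⟨t - q, lt_tsub_iff_left.2 ht, ?_⟩
          rw [add_tsub_cancel_of_le hqt]
      obtain ⟨i, hi1, hi2⟩ := exists_clock_mem hv
      exact ⟨i, (hCiff i).2 ⟨ρ, hi1, hρ⟩,
        (WithTop.coe_lt_coe.2 (add_lt_add_right hi2 q)).trans_le hvj⟩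

variable {E : Set ℝ} {law : Kernel E CadlagPath}

/-- The strong Markov property for events depending on the sampled path only. -/
theorem IsStrongMarkov.measure_inter_sample (hM : IsStrongMarkov P 𝔽 X E law)
    {τ : Ω → WithTop ℝ≥0} (hτ : IsStoppingTime 𝔽 τ) {A : Set Ω}
    (hA : MeasurableSet[hτ.measurableSpace] A) {Z : Set (ℕ → ℝ)} (hZ : MeasurableSet Z) :
    P (A ∩ {ω | τ ω < ⊤ ∧ sample (fun t => X ((τ ω).untopA + t) ω) ∈ Z}) =
      ∫⁻ ω in A ∩ {ω | τ ω < ⊤}, law ⟨stoppedValue X τ ω, hM.mem_state (τ ω).untopA ω⟩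
        {p : CadlagPath | sample p.1 ∈ Z} ∂P :=
  hM.strong_markov τ hτ A hA _ (measurable_sample hZ)

/-- The Markov property for events depending on the sampled path only. -/
theorem IsStrongMarkov.measure_inter_sample_const (hM : IsStrongMarkov P 𝔽 X E law) {q : ℝ≥0}
    {A : Set Ω} (hA : MeasurableSet[𝔽 q] A) {Z : Set (ℕ → ℝ)} (hZ : MeasurableSet Z) :
    P (A ∩ {ω | sample (fun t => X (q + t) ω) ∈ Z}) =
      ∫⁻ ω in A, law ⟨X q ω, hM.mem_state q ω⟩ {p : CadlagPath | sample p.1 ∈ Z} ∂P := by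
  have hA' : MeasurableSet[(isStoppingTime_const 𝔽 q).measurableSpace] A := by
    rwa [IsStoppingTime.measurableSpace_const]
  have h := hM.measure_inter_sample (isStoppingTime_const 𝔽 q) hA' hZ
  simpa only [WithTop.coe_lt_top, true_and, Set.ofPred_true, Set.inter_univ, stoppedValue_const,
    untopA_coe] using h

theorem measurable_law_sample (law : Kernel E CadlagPath) {Z : Set (ℕ → ℝ)}
    (hZ : MeasurableSet Z) : Measurable fun x => law x {p : CadlagPath | sample p.1 ∈ Z} :=
  law.measurable_coe ((measurable_sample.comp measurable_subtype_coe) hZ)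

/-- From a regular point, almost every path returns to it while remaining close. -/
theorem IsStrongMarkov.exists_returns (hM : IsStrongMarkov P 𝔽 X E law) {ε : ℝ} (hε : 0 < ε)
    {x : E} (hx : IsRegularPoint (law x) x) :
    ∀ᵐ p ∂(law x), ∃ (n : ℕ) (s : ℝ≥0), Returns (1 / ((n : ℝ≥0) + 1)) ε p.1 s := by
  filter_upwards [hx, hM.start x] with p hp h0
  have h1 : ∀ᶠ r in 𝓝[≥] (0 : ℝ≥0), |p.1 r - p.1 0| < ε / 2 := by
    have h2 : Tendsto (fun r => |p.1 r - p.1 0|) (𝓝[≥] 0) (𝓝 |p.1 0 - p.1 0|) :=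
      ((p.2 0).1.tendsto.sub_const _).abs
    rw [sub_self, abs_zero] at h2
    exact h2.eventually (Iio_mem_nhds (half_pos hε))
  obtain ⟨v, hv, hv'⟩ := (mem_nhdsGE_iff_exists_Ico_subset' (zero_lt_one' ℝ≥0)).1 h1
  obtain ⟨s, hs0, hsv, hs⟩ := hp v hv
  obtain ⟨n, hn⟩ := exists_nat_one_div_lt hs0
  obtain ⟨m, hm⟩ := exists_nat_one_div_lt (half_pos hε)
  refine ⟨n, s, hn.le, hs.trans h0.symm, m, fun r hr => ?_⟩
  have h3 : |p.1 r - p.1 0| < ε / 2 := hv' ⟨zero_le, hr.trans hsv⟩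
  linarith

/-- From a time `q` on, almost every path of a strong Markov process with regular points returns
to its value at `q` while remaining close. -/
theorem IsStrongMarkov.ae_exists_returns [IsProbabilityMeasure P]
    (hM : IsStrongMarkov P 𝔽 X E law) (hX : IsAdaptedCadlag 𝔽 X)
    (hreg : ∀ x : E, IsRegularPoint (law x) x) (q : ℝ≥0) {ε : ℝ} (hε : 0 < ε) :
    ∀ᵐ ω ∂P, ∃ (n : ℕ) (s : ℝ≥0), Returns (1 / ((n : ℝ≥0) + 1)) ε (fun r => X (q + r) ω) s := by
  let Ψ : Ω → ℕ → ℝ := fun ω => sample fun r => X (q + r) ω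
  have hΨ : Measurable Ψ := measurable_pi_lambda _ fun i => (hX.adapted _).mono (𝔽.le _) le_rfl
  let A : Set (ℕ → ℝ) := ⋃ n : ℕ,
    Prod.fst '' (returnSet (1 / ((n : ℝ≥0) + 1)) ε ∩ Set.univ ×ˢ Set.univ)
  have hmem : ∀ y : ℝ≥0 → ℝ, (∀ t, ContinuousWithinAt y (Set.Ici t) t) →
      (sample y ∈ A ↔ ∃ (n : ℕ) (s : ℝ≥0), Returns (1 / ((n : ℝ≥0) + 1)) ε y s) := by
    intro y hy
    rw [Set.mem_iUnion]
    refine exists_congr fun n => ?_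
    constructor
    · rintro ⟨⟨z, s⟩, ⟨h1, -⟩, h3⟩
      have h3' : z = sample y := h3
      exact ⟨s, (sample_mem_returnSet_iff hy).1 (h3' ▸ h1)⟩
    · rintro ⟨s, hs⟩
      exact ⟨(sample y, s), ⟨(sample_mem_returnSet_iff hy).2 hs, trivial, trivial⟩, rfl⟩
  have hA : AnalyticSet A := AnalyticSet.iUnion fun n =>
    analyticSet_image_returnSet _ ε MeasurableSet.univ
  obtain ⟨C, D, hCA, hAD, hC, hD, hae⟩ := exists_measurableSet_between_analyticSet (P.map Ψ) hA
  -- The Borel hull `D` serves all the laws at once, while `D` and `C` are known to agree only up to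
  -- a null set of `P.map Ψ`. Hence the Markov property is applied to `Dᶜ`, and `C` enters only
  -- under `P`.
  have hlaw : ∀ x : E, law x {p : CadlagPath | sample p.1 ∈ Dᶜ} = 0 := by
    intro x
    rw [measure_eq_zero_iff_ae_notMem]
    filter_upwards [hM.exists_returns hε (hreg x)] with p hp h
    exact h (hAD ((hmem p.1 fun t => (p.2 t).1).2 hp))
  have hD0 : P (Set.univ ∩ {ω | Ψ ω ∈ Dᶜ}) = 0 := by
    rw [hM.measure_inter_sample_const MeasurableSet.univ hD.compl]
    simp_rw [hlaw, lintegral_zero]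
  rw [Set.univ_inter] at hD0
  filter_upwards [measure_eq_zero_iff_ae_notMem.1 hD0, ae_of_ae_map hΨ.aemeasurable hae]
    with ω h1 h2
  exact (hmem _ (hX.continuousWithinAt_add ω q)).1 (hCA (h2 (not_not.1 h1)))

/-- If the probability of remaining close for the time `v` is positive and that of remaining close
for the time `δ + v` is zero, there is a.s. no return after `δ`. -/
theorem IsStrongMarkov.measure_return_eq_zero [IsProbabilityMeasure P]
    (hM : IsStrongMarkov P 𝔽 X E law) (hX : IsAdaptedCadlag 𝔽 X) {q δ v : ℝ≥0} {ε : ℝ}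
    {B : Set Ω} (hB : MeasurableSet[𝔽 q] B)
    (hv : ∀ ω ∈ B, law ⟨X q ω, hM.mem_state q ω⟩ {p : CadlagPath | sample p.1 ∈ stayed ε v} ≠ 0)
    (hδv : ∀ ω ∈ B,
      law ⟨X q ω, hM.mem_state q ω⟩ {p : CadlagPath | sample p.1 ∈ stayed ε (δ + v)} = 0)
    {κ : Ω → WithTop ℝ≥0} (hκ : IsStoppingTime 𝔽 κ) (hqκ : ∀ ω, q ≤ κ ω)
    (hret : ∀ᵐ ω ∂P, κ ω < ⊤ →
      ∃ ρ : ℝ≥0, κ ω = (q + ρ : ℝ≥0) ∧ Returns δ ε (fun r => X (q + r) ω) ρ) :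
    P (B ∩ {ω | κ ω < ⊤}) = 0 := by
  have hBκ : MeasurableSet[hκ.measurableSpace] B := by
    refine (isStoppingTime_const 𝔽 q).measurableSpace_mono hκ hqκ B ?_
    rwa [IsStoppingTime.measurableSpace_const]
  have hprog : IsStronglyProgressive 𝔽 X :=
    isStronglyProgressive_of_rightContinuous hX.adapted fun ω t => (hX.cadlag ω t).1
  have hXκ : Measurable (stoppedValue X κ) :=
    (measurable_stoppedValue hprog hκ).mono hκ.measurableSpace_le le_rfl
  have hlong : P (B ∩ {ω | sample (fun t => X (q + t) ω) ∈ stayed ε (δ + v)}) = 0 := by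
    rw [hM.measure_inter_sample_const hB (measurableSet_stayed _ _),
      setLIntegral_congr_fun (g := fun _ => 0) (𝔽.le q _ hB) hδv, lintegral_zero]
  -- Returning no earlier than `δ` and then remaining close for `v` amounts to remaining close for
  -- `δ + v`.
  have hpost : P (B ∩ {ω | κ ω < ⊤ ∧
      sample (fun t => X ((κ ω).untopA + t) ω) ∈ stayed ε v}) = 0 := by
    rw [measure_eq_zero_iff_ae_notMem] at hlong ⊢
    filter_upwards [hlong, hret] with ω h1 h2
    rintro ⟨hωB, hκω, hs⟩
    obtain ⟨ρ, hρ, hr⟩ := h2 hκω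
    rw [hρ, untopA_coe] at hs
    simp_rw [add_assoc] at hs
    refine h1 ⟨hωB, hr.stayed_add (hX.continuousWithinAt_add ω q) hs fun t => ?_⟩
    simp_rw [← add_assoc]
    exact hX.continuousWithinAt_add ω (q + ρ) t
  rw [hM.measure_inter_sample hκ hBκ (measurableSet_stayed _ _)] at hpost
  have hzero := (lintegral_eq_zero_iff
    ((measurable_law_sample law (measurableSet_stayed ε v)).comp
      (hXκ.subtype_mk (h := fun ω => hM.mem_state (κ ω).untopA ω)))).1 hpost
  have hmeas : MeasurableSet (B ∩ {ω | κ ω < ⊤}) :=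
    (𝔽.le q _ hB).inter (measurableSet_lt (hκ.measurable.mono hκ.measurableSpace_le le_rfl)
      measurable_const)
  rw [EventuallyEq, ae_restrict_iff' hmeas] at hzero
  rw [measure_eq_zero_iff_ae_notMem]
  filter_upwards [hzero, hret] with ω h1 h2 h3
  obtain ⟨ρ, hρ, hr⟩ := h2 h3.2
  -- At the return the process restarts from `X q`, where the integrand just shown to vanish is
  -- non-zero by `hv`.
  have hval : stoppedValue X κ ω = X q ω := by
    have := hr.2.1
    rw [stoppedValue, hρ, untopA_coe]
    simpa only [add_zero] using this
  refine hv ω h3.1 ?_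
  have h4 : (⟨stoppedValue X κ ω, hM.mem_state (κ ω).untopA ω⟩ : E) =
      ⟨X q ω, hM.mem_state q ω⟩ := Subtype.ext hval
  have h5 := h1 h3
  simp only [Pi.zero_apply, Function.comp_apply] at h5
  rwa [h4] at h5

/-- A strong Markov process all of whose points are regular is sticky at deterministic times. -/
theorem IsStrongMarkov.staysClose [IsProbabilityMeasure P] (hF : 𝔽.IsRightContinuous)
    (hM : IsStrongMarkov P 𝔽 X E law) (hX : IsAdaptedCadlag 𝔽 X)
    (hreg : ∀ x : E, IsRegularPoint (law x) x) : StaysClose P 𝔽 X := by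
  classical
  intro q u ε hε B hB hleave
  have := hM.isMarkovKernel
  let F : ℝ≥0 → Ω → ℝ≥0∞ := fun v ω =>
    law ⟨X q ω, hM.mem_state q ω⟩ {p : CadlagPath | sample p.1 ∈ stayed ε v}
  have hFm : ∀ v, Measurable[𝔽 q] (F v) := fun v =>
    (measurable_law_sample law (measurableSet_stayed ε v)).comp (hX.adapted q).subtype_mk
  have hF0 : ∀ ω, F 0 ω ≠ 0 := by
    intro ω
    simp [F, stayed_zero]
  have hFanti : ∀ ω {v w : ℝ≥0}, v ≤ w → F v ω = 0 → F w ω = 0 := fun ω v w hvw h =>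
    measure_mono_null (fun p hp => stayed_anti ε hvw hp) h
  -- `stayed` constrains only times strictly before its bound; `u + 1` includes a departure at time
  -- `u` itself.
  have hFu : ∀ᵐ ω ∂P, ω ∈ B → F (u + 1) ω = 0 := by
    have h1 : P (B ∩ {ω | sample (fun t => X (q + t) ω) ∈ stayed ε (u + 1)}) = 0 := by
      rw [measure_eq_zero_iff_ae_notMem]
      filter_upwards [hleave] with ω h1 h2
      obtain ⟨s, hs, h3⟩ := h1 h2.1
      obtain ⟨m, hm⟩ := (sample_mem_stayed_iff (hX.continuousWithinAt_add ω q)).1 h2.2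
      have h4 := hm s (hs.trans_lt (lt_add_one u))
      simp only [add_zero] at h4
      have h5 : 0 < 1 / ((m : ℝ) + 1) := by positivity
      linarith
    rw [hM.measure_inter_sample_const hB (measurableSet_stayed _ _),
      lintegral_eq_zero_iff ((hFm (u + 1)).mono (𝔽.le q) le_rfl)] at h1
    exact (ae_restrict_iff' (𝔽.le q _ hB)).1 h1
  have hnone : ∀ n : ℕ, ∀ᵐ ω ∂P, ω ∈ B →
      ¬ ∃ s, Returns (1 / ((n : ℝ≥0) + 1)) ε (fun r => X (q + r) ω) s := by
    intro n
    set δ : ℝ≥0 := 1 / ((n : ℝ≥0) + 1) with hδ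
    have hδ0 : 0 < δ := by positivity
    obtain ⟨κ, hκ, hqκ, hret⟩ := exists_isStoppingTime_first_return (P := P) hF hX q δ ε
    have hk : ∀ k : ℕ, P (B ∩ {ω | F (k * δ) ω ≠ 0} ∩ {ω | F (δ + k * δ) ω = 0} ∩
        {ω | κ ω < ⊤}) = 0 := by
      intro k
      refine hM.measure_return_eq_zero hX ((hB.inter ?_).inter ?_) (fun ω h => h.1.2)
        (fun ω h => h.2) hκ hqκ (hret.mono fun ω h => h.2)
      · exact (hFm _ (measurableSet_singleton 0)).compl
      · exact hFm _ (measurableSet_singleton 0)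
    filter_upwards [hret, hFu, ae_all_iff.2 fun k => measure_eq_zero_iff_ae_notMem.1 (hk k)]
      with ω h1 h2 h3 hωB h4
    -- The least such index is positive because `F 0 ≠ 0`; its predecessor `j` places the outcome in
    -- the event that `hk j` shows to be null.
    have hex : ∃ k : ℕ, F (k * δ) ω = 0 := by
      obtain ⟨k, hk⟩ := exists_nat_gt ((u + 1) / δ)
      exact ⟨k, hFanti ω ((div_lt_iff₀ hδ0).1 hk).le (h2 hωB)⟩
    obtain ⟨j, hj⟩ : ∃ j, Nat.find hex = j + 1 := by
      refine Nat.exists_eq_succ_of_ne_zero fun h => ?_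
      have := Nat.find_spec hex
      rw [h, Nat.cast_zero, zero_mul] at this
      exact hF0 ω this
    refine h3 j ⟨⟨⟨hωB, Nat.find_min hex (hj ▸ Nat.lt_succ_self j)⟩, ?_⟩, h1.1 h4⟩
    have h5 := Nat.find_spec hex
    rw [hj, Nat.cast_add, Nat.cast_one, add_mul, one_mul, add_comm] at h5
    exact h5
  rw [measure_eq_zero_iff_ae_notMem]
  filter_upwards [ae_all_iff.2 hnone, hM.ae_exists_returns hX hreg q hε] with ω h1 h2 hωB
  obtain ⟨n, s, hs⟩ := h2
  exact h1 n hωB ⟨s, hs⟩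

end

end SimpleTrading

theorem corollary2p4 {Ω : Type*} {mΩ : MeasurableSpace Ω}
    (P : MeasureTheory.Measure Ω) [MeasureTheory.IsProbabilityMeasure P]
    (𝔽 : MeasureTheory.Filtration ℝ≥0 mΩ) (h𝔽 : SimpleTrading.UsualHypotheses P 𝔽)
    (X : ℝ≥0 → Ω → ℝ) (hX_nonneg : ∀ t ω, 0 ≤ X t ω)
    (hX : SimpleTrading.IsSemimartingale P 𝔽 X)
    (hQ : ∃ Q : MeasureTheory.Measure Ω, SimpleTrading.IsELMM P Q 𝔽 X) :
    (SimpleTrading.IsSticky P 𝔽 X → SimpleTrading.NoArbitrage P 𝔽 X) ∧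
    (∀ (E : Set ℝ) (law : ProbabilityTheory.Kernel E SimpleTrading.CadlagPath),
      SimpleTrading.IsStrongMarkov P 𝔽 X E law →
      (∀ x : E, SimpleTrading.IsRegularPoint (law x) x) →
      SimpleTrading.NoArbitrage P 𝔽 X) := by
  obtain ⟨Q, hQ⟩ := hQ
  refine ⟨fun hS => hS.staysClose.noArbitrage hX_nonneg hQ, fun E law hM hreg => ?_⟩
  exact (hM.staysClose h𝔽.rightContinuous hX.toIsAdaptedCadlag hreg).noArbitrage hX_nonneg hQ
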